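/- Let $n\ge 3$ and let $W_n$ be the wheel graph: a cycle on the vertices $v_0,\dots,v_{n-1}$ (indices modulo $n$) together with one further vertex $s$ adjacent to every $v_i$. Take $s$ as the sink. A sandpile on $W_n$ is a function $c:\{v_0,\dots,v_{n-1}\}\to\mathbb{Z}_{\ge 0}$. A vertex $v_i$ is unstable if $c(v_i)\ge \deg(v_i)$, and an unstable vertex topples by sending one grain along each of its edges (grains sent to $s$ are lost). A sandpile is stable if it has no unstable vertex; the stabilization of a sandpile is the stable sandpile reached by toppling unstable vertices, and its toppling vector $(t_0,\dots,t_{n-1})$ records how many times each $v_i$ topples (neither depends on the order of topplings). A stable sandpile $c$ is recurrent if for every sandpile $a$ there is a sandpile $b$ such that $c$ is the stabilization of $a+b$. The multivariate avalanche polynomial of $W_n$ is $$\mathscr{A}_{W_n}(x_0,\dots,x_{n-1})=\sum_{c\ \text{recurrent}}\ \sum_{k=0}^{n-1}\ \prod_{i=0}^{n-1}x_i^{t_i(c,k)},$$ where $(t_0(c,k),\dots,t_{n-1}(c,k))$ is the toppling vector of the stabilization of $c+1_{v_k}$, the sandpile obtained from $c$ by adding one grain at $v_k$. For $1\le m\le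 n-1$ let $$w_m=\sum_{i=0}^{n-1}x_i x_{i+1}\cdots x_{i+m-1}\qquad(\text{indices modulo } n),$$ and let $(f_k)$ be the Fibonacci numbers with $f_0=0$, $f_1=f_2=1$, $f_{k}=f_{k-1}+f_{k-2}$. Then $$\mathscr{A}_{W_n}=n^2\,x_0x_1\cdots x_{n-1}+\sum_{m=1}^{n-1} m\,f_{2(n-m)}\,w_m+2n\,(f_{2n-1}-1).$$ -/

import Mathlib

namespace AvalancheGraph

/-- A sandpile on a graph with vertex set `V` and sink `s`: a number of grains on each
non-sink vertex. -/
abbrev Sandpile {V : Type*} (s : V) : Type _ := {v : V // v ≠ s} → ℕ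

section Sandpiles

variable {V : Type*} [Fintype V] [DecidableEq V] (G : SimpleGraph V) [DecidableRel G.Adj] {s : V}

/-- The non-sink vertex `v` is unstable: it has at least as many grains as its degree in `G`
(edges to the sink are counted). -/
def IsUnstableAt (c : Sandpile s) (v : {v : V // v ≠ s}) : Prop :=
  G.degree v.1 ≤ c v

/-- A sandpile is stable if no non-sink vertex is unstable. -/
def IsStable (c : Sandpile s) : Prop :=
  ∀ v, c v < G.degree v.1

/-- The sandpile obtained by toppling `v`: one grain is sent along every edge at `v`.
Only used when `v` is unstable, so that the subtraction is exact. -/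
def topple (c : Sandpile s) (v : {v : V // v ≠ s}) : Sandpile s := fun w =>
  if w = v then c v - G.degree v.1 else c w + (if G.Adj v.1 w.1 then 1 else 0)

/-- `TopplesTo G c l c'`: toppling the vertices of the list `l` in order, each of them being
unstable at the moment when it topples, sends `c` to `c'`. -/
inductive TopplesTo : Sandpile s → List {v : V // v ≠ s} → Sandpile s → Prop
  | nil (c : Sandpile s) : TopplesTo c [] c
  | cons {c c' : Sandpile s} {v : {v : V // v ≠ s}} {l : List {v : V // v ≠ s}}
      (hv : IsUnstableAt G c v) (h : TopplesTo (topple G c v) l c') : TopplesTo c (v :: l) c'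

/-- `c'` is the stabilization of `c`: it is stable and is reached from `c` by a sequence of
topplings of unstable vertices. -/
def IsStabilization (c c' : Sandpile s) : Prop :=
  IsStable G c' ∧ ∃ l, TopplesTo G c l c'

/-- A sandpile `c` is recurrent if it is stable and for every sandpile `a` there is a sandpile
`b` such that `c` is the stabilization of `a + b`. -/
def IsRecurrent (c : Sandpile s) : Prop :=
  IsStable G c ∧ ∀ a : Sandpile s, ∃ b : Sandpile s, IsStabilization G (a + b) c

/-- `f` is the toppling vector of a stabilization of `c`: `f v` is the number of times that `v`
topples. -/
def IsTopplingVector (c : Sandpile s) (f : {v : V // v ≠ s} → ℕ) : Prop :=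
  ∃ (l : List {v : V // v ≠ s}) (c' : Sandpile s),
    TopplesTo G c l c' ∧ IsStable G c' ∧ ∀ v, f v = l.count v

open Classical in
/-- The toppling vector of the stabilization of `c`. On a connected graph it exists and does
not depend on the order of the topplings. -/
noncomputable def topplingVector (c : Sandpile s) : {v : V // v ≠ s} → ℕ :=
  if h : ∃ f, IsTopplingVector G c f then h.choose else 0

/-- The avalanche monomial of `c` at `v`: the monomial whose exponents are the entries of the
toppling vector of the stabilization of `c + 1_v`. -/
noncomputable def avalancheMonomial (c : Sandpile s) (v : {v : V // v ≠ s}) :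
    MvPolynomial {v : V // v ≠ s} ℤ :=
  ∏ u, MvPolynomial.X u ^ topplingVector G (c + Pi.single v 1) u

open Classical in
/-- The finite set of recurrent sandpiles on `G` with sink `s`. -/
noncomputable def recurrents (s : V) : Finset (Sandpile s) :=
  (Fintype.piFinset fun v : {v : V // v ≠ s} => Finset.range (G.degree v.1)).filter
    fun c => IsRecurrent G c

theorem mem_recurrents (c : Sandpile s) : c ∈ recurrents G s ↔ IsRecurrent G c := by
  simp only [recurrents, Finset.mem_filter, Fintype.mem_piFinset, Finset.mem_range]
  exact ⟨fun h => h.2, fun h => ⟨h.1, h⟩⟩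

/-- The multivariate avalanche polynomial of `G` with sink `s`. -/
noncomputable def avalanchePolynomial (s : V) : MvPolynomial {v : V // v ≠ s} ℤ :=
  ∑ c ∈ recurrents G s, ∑ v, avalancheMonomial G c v

end Sandpiles

/-- Adjacency in the wheel: `some i` are the vertices of the cycle, `none` is the dominating
vertex. -/
def wheelAdj (n : ℕ) : Option (Fin n) → Option (Fin n) → Prop
  | none, none => False
  | none, some _ => True
  | some _, none => True
  | some i, some j => (SimpleGraph.cycleGraph n).Adj i j

/-- The wheel graph: a cycle on `n` vertices and a dominating vertex. -/
def wheelGraph (n : ℕ) : SimpleGraph (Option (Fin n)) where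
  Adj := wheelAdj n
  symm := ⟨by
    rintro (_ | i) (_ | j) h
    · exact h
    · trivial
    · trivial
    · exact SimpleGraph.Adj.symm (G := SimpleGraph.cycleGraph n) h⟩
  loopless := ⟨by
    rintro (_ | i) h
    · exact h
    · exact (SimpleGraph.cycleGraph n).irrefl h⟩

instance (n : ℕ) : DecidableRel (wheelGraph n).Adj
  | none, none => inferInstanceAs (Decidable False)
  | none, some _ => inferInstanceAs (Decidable True)
  | some _, none => inferInstanceAs (Decidable True)
  | some i, some j => inferInstanceAs (Decidable ((SimpleGraph.cycleGraph n).Adj i j))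

/-- The variable `x_i` attached to the cycle vertex `i` of the wheel. -/
noncomputable def wheelVar (n : ℕ) (i : Fin n) :
    MvPolynomial {v : Option (Fin n) // v ≠ none} ℤ :=
  MvPolynomial.X ⟨some i, Option.some_ne_none i⟩

/-- The cyclic polynomial `∑ i, x_i x_{i+1} ⋯ x_{i+m-1}`, indices modulo `n`. -/
def cyclicPolynomial {R : Type*} [CommSemiring R] {n : ℕ} (m : ℕ) (x : Fin n → R) : R :=
  ∑ i : Fin n, ∏ k ∈ Finset.range m, x ⟨(i.1 + k) % n, Nat.mod_lt _ i.pos⟩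

end AvalancheGraph

/-! By Dhar's burning criterion, a stable sandpile on the wheel is recurrent iff no nonempty set of
rim vertices is forbidden, i.e. gives each of its members more neighbours inside the set than it has
grains. Rim vertices have degree 3, so stable sandpiles are cyclic words over {0, 1, 2}; the
recurrent ones contain a 2 and have a 2 between any two cyclically consecutive 0s (`isGood_iff`). A
two-state automaton recognises them, and a trace of transfer matrices counts them
(`card_isGood_add`); the matrix of an unrestricted letter is the square of the Fibonacci matrix,
whence the even and odd Fibonacci indices.

Now add a grain at `k`. If the letter there is not 2, nothing topples: for each `k` there are `2 *
fib (2n - 1) - 2` such words. If it is 2, the maximal arc of 2s around `k` topples, once per vertex,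
and each vertex bordering the arc gains one grain and stays stable. The exception is a complement
with at most one vertex. If all letters are 2, or the only other letter is a 1 (which receives two
grains), the whole rim topples once; each `k` sees `n` such words, which gives `n ^ 2`. If the only
other letter is a 0, the arc of length `n - 1` topples alone. A given arc of length `m` is maximal
in this sense for `fib (2(n - m))` words and is triggered from `m` positions
(`avalancheMonomial_eq_sum`, `card_isGood_isArc`, `card_isGood_isFull`). -/

namespace AvalancheGraph

/-! ### Toppling sequences, the least action principle and Dhar's criterion -/

section Sandpiles

variable {V : Type*} [Fintype V] [DecidableEq V] (G : SimpleGraph V) [DecidableRel G.Adj] {s : V}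

variable {G}

/-- Balance of grains at `v`: losses are put on the left so that no truncated subtraction occurs. -/
theorem TopplesTo.apply_add_count_mul {c c' : Sandpile s} {l : List {v : V // v ≠ s}}
    (h : TopplesTo G c l c') (v : {v : V // v ≠ s}) :
    c' v + l.count v * G.degree v.1 =
      c v + ∑ w, l.count w * (if G.Adj w.1 v.1 then 1 else 0) := by
  induction h with
  | nil c => simp
  | @cons c c' u l hu h ih =>
    have hsum : ∑ w, (u :: l).count w * (if G.Adj w.1 v.1 then 1 else 0)
        = ∑ w, l.count w * (if G.Adj w.1 v.1 then 1 else 0)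
          + (if G.Adj u.1 v.1 then 1 else 0) := by
      simp only [List.count_cons, add_mul, Finset.sum_add_distrib, beq_iff_eq, ite_mul, one_mul,
        zero_mul, Finset.sum_ite_eq, Finset.mem_univ, if_true]
    rw [hsum]
    unfold IsUnstableAt at hu
    by_cases huv : v = u
    · subst huv
      simp only [topple, if_true] at ih
      simp only [List.count_cons_self, add_mul, one_mul, SimpleGraph.irrefl, if_false]
      omega
    · simp only [topple, if_neg huv] at ih
      rw [List.count_cons_of_ne (Ne.symm huv)]
      omega

theorem TopplesTo.add_right {c c' : Sandpile s} {l : List {v : V // v ≠ s}}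
    (h : TopplesTo G c l c') (d : Sandpile s) : TopplesTo G (c + d) l (c' + d) := by
  induction h with
  | nil c => exact .nil _
  | @cons c c' u l hu h ih =>
    unfold IsUnstableAt at hu
    refine .cons (le_trans hu (by simp)) ?_
    convert ih using 1
    funext w
    by_cases hw : w = u
    · subst hw
      simp only [topple, Pi.add_apply, if_true]
      omega
    · simp only [topple, Pi.add_apply, if_neg hw]
      omega

theorem TopplesTo.append {c c' c'' : Sandpile s} {l l' : List {v : V // v ≠ s}}
    (h : TopplesTo G c l c') (h' : TopplesTo G c' l' c'') : TopplesTo G c (l ++ l') c'' := by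
  induction h with
  | nil c => exact h'
  | cons hu _ ih => exact .cons hu (ih h')

theorem TopplesTo.of_append {l l' : List {v : V // v ≠ s}} {c c'' : Sandpile s}
    (h : TopplesTo G c (l ++ l') c'') : ∃ c', TopplesTo G c l c' ∧ TopplesTo G c' l' c'' := by
  induction l generalizing c with
  | nil => exact ⟨c, .nil _, h⟩
  | cons u l ih =>
    cases h with
    | cons hu h =>
      obtain ⟨c', h1, h2⟩ := ih h
      exact ⟨c', .cons hu h1, h2⟩

/-- The least action principle: a legal toppling sequence never topples a vertex more often than
a stabilizing one does. -/
theorem TopplesTo.count_le {c c' : Sandpile s} {l : List {v : V // v ≠ s}}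
    (h : TopplesTo G c l c') (hc' : IsStable G c') {l₂ : List {v : V // v ≠ s}} {c₂ : Sandpile s}
    (h₂ : TopplesTo G c l₂ c₂) (v : {v : V // v ≠ s}) : l₂.count v ≤ l.count v := by
  induction l₂ using List.reverseRecOn generalizing c₂ v with
  | nil => simp
  | append_singleton l₂ u ih =>
    obtain ⟨c₁, h₁, hu⟩ := h₂.of_append
    cases hu with
    | cons hu _ =>
      have ih := fun v => ih h₁ v
      rw [List.count_append]
      by_cases huv : u = v
      · subst huv
        simp only [List.count_singleton_self]
        -- Otherwise `u` has already toppled as often as in `l`, while its neighbours have toppled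
        -- at most as often; so it holds at most `c' u` grains and is stable.
        by_contra hlt
        have heq : l₂.count u = l.count u := le_antisymm (ih u) (by omega)
        have e₁ := h₁.apply_add_count_mul u
        have e := h.apply_add_count_mul u
        have hle : ∑ w, l₂.count w * (if G.Adj w.1 u.1 then 1 else 0)
            ≤ ∑ w, l.count w * (if G.Adj w.1 u.1 then 1 else 0) :=
          Finset.sum_le_sum fun w _ => Nat.mul_le_mul_right _ (ih w)
        have := hc' u
        unfold IsUnstableAt at hu
        rw [heq] at e₁
        omega
      · rw [List.count_eq_zero_of_not_mem (l := [u]) (by simpa using Ne.symm huv)]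
        exact ih v

theorem IsTopplingVector.topplingVector_eq {c : Sandpile s} {f : {v : V // v ≠ s} → ℕ}
    (hf : IsTopplingVector G c f) : topplingVector G c = f := by
  have hex : ∃ f, IsTopplingVector G c f := ⟨f, hf⟩
  rw [topplingVector, dif_pos hex]
  obtain ⟨l, c', h, hs, hl⟩ := hf
  obtain ⟨l₂, c₂, h₂, hs₂, hl₂⟩ := hex.choose_spec
  funext v
  rw [hl₂, hl]
  exact le_antisymm (h.count_le hs h₂ v) (h₂.count_le hs₂ h v)

theorem sum_count_mul_of_nodup {l : List {v : V // v ≠ s}} (hl : l.Nodup) (v : V) :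
    ∑ w, l.count w * (if G.Adj w.1 v then 1 else 0)
      = (l.toFinset.filter fun w => G.Adj w.1 v).card := by
  rw [Finset.card_filter, ← Finset.sum_subset (Finset.subset_univ l.toFinset)]
  · refine Finset.sum_congr rfl fun w hw => ?_
    rw [List.count_eq_one_of_mem hl (List.mem_toFinset.1 hw), one_mul]
  · intro w _ hw
    rw [List.count_eq_zero_of_not_mem (by simpa using hw), zero_mul]

/-- The vertices of `T` can be toppled legally, once each, as soon as no nonempty part of `T`
blocks the avalanche. -/
theorem exists_topplesTo_of_forall_subset (d : Sandpile s) (T : Finset {v : V // v ≠ s})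
    (hT : ∀ S ⊆ T, S.Nonempty → ∃ v ∈ S,
      G.degree v.1 ≤ d v + ((T \ S).filter fun w => G.Adj w.1 v.1).card) :
    ∃ l : List {v : V // v ≠ s}, l.Nodup ∧ l.toFinset = T ∧ ∃ d', TopplesTo G d l d' := by
  have key : ∀ k ≤ T.card, ∃ l : List {v : V // v ≠ s}, l.Nodup ∧ l.toFinset ⊆ T ∧ l.length = k ∧
      ∃ d', TopplesTo G d l d' := by
    intro k
    induction k with
    | zero => exact fun _ => ⟨[], by simp, by simp, rfl, d, .nil _⟩
    | succ k ih =>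
      intro hk
      obtain ⟨l, hl, hlT, hlen, d', h⟩ := ih (by omega)
      have hcard : l.toFinset.card = k := by rw [List.toFinset_card_of_nodup hl, hlen]
      have hne : (T \ l.toFinset).Nonempty := by
        rw [← Finset.card_pos, Finset.card_sdiff_of_subset hlT]
        omega
      -- Here `S` is the part of `T` still to topple, so `T \ S` is what has toppled and sent its
      -- grains.
      obtain ⟨v, hv, hdeg⟩ := hT _ Finset.sdiff_subset hne
      rw [Finset.sdiff_sdiff_eq_self hlT] at hdeg
      have hvl : v ∉ l := by
        have := (Finset.mem_sdiff.1 hv).2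
        simpa using this
      have e := h.apply_add_count_mul v
      rw [sum_count_mul_of_nodup hl, List.count_eq_zero_of_not_mem hvl] at e
      refine ⟨l ++ [v], ?_, ?_, by simp [hlen], topple G d' v, h.append (.cons ?_ (.nil _))⟩
      · rw [List.nodup_append]
        refine ⟨hl, by simp, ?_⟩
        rintro a ha b hb rfl
        simp only [List.mem_singleton] at hb
        exact hvl (hb ▸ ha)
      · intro w hw
        simp only [List.mem_toFinset, List.mem_append, List.mem_singleton] at hw
        rcases hw with hw | rfl
        · exact hlT (by simpa using hw)
        · exact (Finset.mem_sdiff.1 hv).1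
      · unfold IsUnstableAt
        omega
  obtain ⟨l, hl, hlT, hlen, hd⟩ := key _ le_rfl
  refine ⟨l, hl, Finset.eq_of_subset_of_card_le hlT ?_, hd⟩
  rw [List.toFinset_card_of_nodup hl, hlen]

/-- If the set `T` can be toppled legally, once per vertex, and this makes the sandpile stable,
then the toppling vector is the indicator of `T`. -/
theorem topplingVector_eq_indicator (d : Sandpile s) (T : Finset {v : V // v ≠ s})
    (hT : ∀ S ⊆ T, S.Nonempty → ∃ v ∈ S,
      G.degree v.1 ≤ d v + ((T \ S).filter fun w => G.Adj w.1 v.1).card)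
    (hstable : ∀ v, d v + (T.filter fun w => G.Adj w.1 v.1).card
      < G.degree v.1 + if v ∈ T then G.degree v.1 else 0) :
    topplingVector G d = fun v => if v ∈ T then 1 else 0 := by
  obtain ⟨l, hl, hlT, d', h⟩ := exists_topplesTo_of_forall_subset d T hT
  have hcount : ∀ v, (if v ∈ T then 1 else 0) = l.count v := by
    intro v
    rw [← hlT, hl.count]
    simp
  refine IsTopplingVector.topplingVector_eq ⟨l, d', h, fun v => ?_, hcount⟩
  have e := h.apply_add_count_mul v
  rw [sum_count_mul_of_nodup hl, hlT, ← hcount] at e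
  have := hstable v
  split_ifs at e this <;> omega

theorem degree_eq_card_add (v : {v : V // v ≠ s}) :
    G.degree v.1 = (Finset.univ.filter fun w : {v : V // v ≠ s} => G.Adj w.1 v.1).card
      + if G.Adj v.1 s then 1 else 0 := by
  rw [← G.card_neighborFinset_eq_degree, SimpleGraph.neighborFinset_eq_filter,
    Finset.card_filter, Finset.card_filter,
    ← Finset.sum_erase_add _ _ (Finset.mem_univ s)]
  congr 1
  rw [← Finset.sum_subtype (p := fun w => w ≠ s) (Finset.univ.erase s) (by simp)
    (fun w => if G.Adj w v.1 then 1 else 0)]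
  simp only [G.adj_comm]

/-- Take the vertex of `S` whose last toppling comes earliest. Each of its neighbours in `S` topples
afterwards and leaves it a grain that it keeps. -/
theorem IsRecurrent.exists_card_le {c : Sandpile s} (hc : IsRecurrent G c)
    {S : Finset {v : V // v ≠ s}} (hS : S.Nonempty) :
    ∃ v ∈ S, (S.filter fun w => G.Adj w.1 v.1).card ≤ c v := by
  obtain ⟨hstable, h⟩ := hc
  -- With these grains added every vertex starts unstable, so every vertex has to topple.
  obtain ⟨b, -, l, hl⟩ := h fun v => G.degree v.1
  have hmem : ∀ v, v ∈ l := by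
    intro v
    by_contra hv
    have e := hl.apply_add_count_mul v
    rw [List.count_eq_zero_of_not_mem hv] at e
    have := hstable v
    simp only [Pi.add_apply] at e
    omega
  have hSl : ∀ v ∈ S, v ∈ l := fun v _ => hmem v
  clear hmem h hstable
  revert hl
  generalize ((fun v => G.degree v.1) + b : Sandpile s) = d
  intro hl
  induction hl with
  | nil c =>
    obtain ⟨v, hv⟩ := hS
    simpa using hSl v hv
  | @cons d c u l hu hl ih =>
    by_cases hall : ∀ v ∈ S, v ∈ l
    · exact ih hall
    · push Not at hall
      obtain ⟨v, hv, hvl⟩ := hall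
      obtain rfl : v = u := by simpa [hvl] using hSl v hv
      refine ⟨v, hv, ?_⟩
      have e := hl.apply_add_count_mul v
      rw [List.count_eq_zero_of_not_mem hvl] at e
      have hle : (S.filter fun w => G.Adj w.1 v.1).card
          ≤ ∑ w, l.count w * (if G.Adj w.1 v.1 then 1 else 0) := by
        rw [Finset.card_filter]
        refine (Finset.sum_le_sum fun w hw => ?_).trans
          (Finset.sum_le_sum_of_subset (Finset.subset_univ S))
        by_cases hwv : G.Adj w.1 v.1
        · have hwl : w ∈ l := by
            have hne : w ≠ v := by
              rintro rfl
              exact G.irrefl hwv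
            simpa [hne] using hSl w hw
          simpa [hwv] using hwl
        · simp [hwv]
      omega

/-- Dhar's criterion for a sink adjacent to every other vertex. -/
theorem isRecurrent_iff_of_forall_adj (hs : ∀ v : {v : V // v ≠ s}, G.Adj v.1 s) (c : Sandpile s) :
    IsRecurrent G c ↔ IsStable G c ∧ ∀ S : Finset {v : V // v ≠ s}, S.Nonempty →
      ∃ v ∈ S, (S.filter fun w => G.Adj w.1 v.1).card ≤ c v := by
  refine ⟨fun h => ⟨h.1, fun S hS => h.exists_card_le hS⟩, fun ⟨hstable, h⟩ => ⟨hstable, ?_⟩⟩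
  have hdeg : ∀ v : {v : V // v ≠ s}, G.degree v.1
      = (Finset.univ.filter fun w : {v : V // v ≠ s} => G.Adj w.1 v.1).card + 1 := fun v => by
    rw [degree_eq_card_add v, if_pos (hs v)]
  -- One grain on each vertex is what a toppling of the sink would send. Every vertex then topples
  -- exactly once, which restores `c`.
  have hburn : ∃ l, TopplesTo G (c + 1) l c := by
    obtain ⟨l, hl, hlT, d', hd⟩ := exists_topplesTo_of_forall_subset (G := G) (c + 1) Finset.univ
      (fun S _ hS => by
        obtain ⟨v, hv, hle⟩ := h S hS
        refine ⟨v, hv, ?_⟩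
        have hsplit := Finset.card_union_of_disjoint (Finset.disjoint_filter_filter
          (p := fun w : {v : V // v ≠ s} => G.Adj w.1 v.1) (q := fun w => G.Adj w.1 v.1)
          (Finset.sdiff_disjoint (s := S) (t := Finset.univ)))
        rw [← Finset.filter_union, Finset.sdiff_union_of_subset (Finset.subset_univ S)] at hsplit
        rw [hdeg, hsplit]
        simp only [Pi.add_apply, Pi.one_apply]
        omega)
    refine ⟨l, ?_⟩
    convert hd using 1
    funext v
    have e := hd.apply_add_count_mul v
    rw [sum_count_mul_of_nodup hl, hlT, hl.count, if_pos (by rw [← List.mem_toFinset, hlT]; simp),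
      hdeg] at e
    simp only [Pi.add_apply, Pi.one_apply] at e
    omega
  have hburns : ∀ k : ℕ, ∃ l, TopplesTo G (c + fun _ => k) l c := by
    intro k
    induction k with
    | zero => exact ⟨[], .nil c⟩
    | succ k ih =>
      obtain ⟨l, hl⟩ := ih
      obtain ⟨l', hl'⟩ := hburn
      refine ⟨l' ++ l, TopplesTo.append ?_ hl⟩
      have := hl'.add_right fun _ => k
      convert this using 1
      funext v
      simp only [Pi.add_apply, Pi.one_apply]
      omega
  intro a
  obtain ⟨l, hl⟩ := hburns (∑ v, a v)
  -- The total of `a` serves only as a constant bounding every `a v`.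
  refine ⟨fun v => c v + ((∑ v, a v) - a v), hstable, l, ?_⟩
  convert hl using 1
  funext v
  have := Finset.single_le_sum (f := a) (fun _ _ => Nat.zero_le _) (Finset.mem_univ v)
  simp only [Pi.add_apply]
  omega

end Sandpiles

/-! ### Recurrent sandpiles as cyclic words accepted by an automaton -/

section Words

/-- The automaton reading the words of recurrent sandpiles on the wheel. Its state is `false` while
the last letter other than `1` was a `0`; a further `0` is then refused. -/
def step : Fin 3 → Bool → Option Bool
  | 0, true => some false
  | 0, false => none
  | 1, s => some s
  | 2, _ => some true

theorem step_zero {s u : Bool} : step 0 s = some u ↔ s = true ∧ u = false := by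
  revert s u; decide

theorem step_one {s u : Bool} : step 1 s = some u ↔ u = s := by
  revert s u; decide

theorem step_two {s u : Bool} : step 2 s = some u ↔ u = true := by
  revert s u; decide

theorem step_false {a : Fin 3} {u : Bool} (h : step a false = some u) : a = 1 ∧ u = false ∨ a = 2 := by
  revert a u; decide

theorem eq_one_of_step_ne {a : Fin 3} {s s' u u' : Bool} (h : step a s = some u)
    (h' : step a s' = some u') (hu : u ≠ u') : a = 1 ∧ s ≠ s' := by
  revert a s s' u u'; decide

variable {n : ℕ}

/-- `σ` is a cyclic run of the automaton on the cyclic word `c`. -/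
def IsTrack (c : ZMod n → Fin 3) (σ : ZMod n → Bool) : Prop :=
  ∀ i, step (c i) (σ i) = some (σ (i + 1))

/-- The cyclic words accepted by the automaton, the constant word `1` excluded. -/
def IsGood (c : ZMod n → Fin 3) : Prop :=
  c ≠ 1 ∧ ∃ σ, IsTrack c σ

/-- The letters 0 and 2 determine the state that follows them. Two runs that differ after a letter
therefore read a 1 and differ before it; going backwards, this spreads round the cycle. -/
theorem IsTrack.eq_one_of_ne [NeZero n] {c : ZMod n → Fin 3} {σ τ : ZMod n → Bool}
    (hσ : IsTrack c σ) (hτ : IsTrack c τ) (h : σ 0 ≠ τ 0) : c = 1 := by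
  have key : ∀ t : ℕ, σ (-t) ≠ τ (-t) := by
    intro t
    induction t with
    | zero => simpa using h
    | succ t ih =>
      have heq : -(t : ZMod n) = -((t + 1 : ℕ) : ZMod n) + 1 := by push_cast; ring
      rw [heq] at ih
      exact (eq_one_of_step_ne (hσ _) (hτ _) ih).2
  funext i
  have := key (-(i + 1)).val
  rw [ZMod.natCast_zmod_val, neg_neg] at this
  exact (eq_one_of_step_ne (hσ i) (hτ i) this).1

/-- Without a 2 there is a 0. The state after it stays `false` all the way round to that same 0,
which is then refused. -/
theorem IsGood.exists_eq_two [NeZero n] {c : ZMod n → Fin 3} (hc : IsGood c) : ∃ i, c i = 2 := by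
  obtain ⟨hne, σ, hσ⟩ := hc
  by_contra! h
  obtain ⟨j, hj⟩ : ∃ j, c j = 0 := by
    by_contra! h0
    refine hne (funext fun i => ?_)
    have h1 := h i
    have h2 := h0 i
    simp only [Pi.one_apply]
    generalize c i = a at h1 h2
    revert a; decide
  have hj' := hσ j
  rw [hj, step_zero] at hj'
  have key : ∀ t : ℕ, σ (j + 1 + t) = false := by
    intro t
    induction t with
    | zero => simpa using hj'.2
    | succ t ih =>
      have := hσ (j + 1 + t)
      rw [ih] at this
      rcases step_false this with h1 | h1
      · push_cast
        rw [← add_assoc]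
        exact h1.2
      · exact absurd h1 (h _)
  have := key (n - 1)
  rw [Nat.cast_sub NeZero.one_le] at this
  simp [hj'.1] at this

/-- A forbidden `S` contains no 2, hence is not the whole cycle. The first vertex of a segment of
`S` must carry a 0, which sets the state to `false`; from there on every letter must be a 1 and
pulls its successor into `S`, until `S` reaches the predecessor of the starting vertex. -/
theorem IsGood.exists_card_le [NeZero n] {c : ZMod n → Fin 3} (hc : IsGood c)
    {S : Finset (ZMod n)} (hS : S.Nonempty) :
    ∃ i ∈ S, (if i + 1 ∈ S then 1 else 0) + (if i - 1 ∈ S then 1 else 0) ≤ (c i : ℕ) := by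
  by_contra! h
  obtain ⟨p, hp⟩ := hc.exists_eq_two
  have hpS : p ∉ S := by
    intro hpS
    have := h p hpS
    rw [hp] at this
    simp only [Fin.val_two] at this
    split_ifs at this <;> omega
  obtain ⟨i, hi, hi'⟩ : ∃ i ∈ S, i - 1 ∉ S := by
    by_contra! hall
    obtain ⟨j, hj⟩ := hS
    have key : ∀ t : ℕ, j - t ∈ S := by
      intro t
      induction t with
      | zero => simpa using hj
      | succ t ih =>
        have := hall _ ih
        push_cast
        rwa [← sub_sub]
    refine hpS ?_
    have := key (j - p).val
    rwa [ZMod.natCast_zmod_val, sub_sub_cancel] at this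
  obtain ⟨-, σ, hσ⟩ := hc
  have key : ∀ t : ℕ, i + t ∈ S ∧ i + t + 1 ∈ S ∧ σ (i + t + 1) = false := by
    intro t
    induction t with
    | zero =>
      have h1 := h i hi
      rw [if_neg hi'] at h1
      have h2 : i + 1 ∈ S := by
        by_contra h2
        rw [if_neg h2] at h1
        omega
      rw [if_pos h2] at h1
      have h3 : c i = 0 := Fin.ext (by simpa using h1)
      have h4 := hσ i
      rw [h3, step_zero] at h4
      simpa using ⟨hi, h2, h4.2⟩
    | succ t ih =>
      obtain ⟨-, h1, h2⟩ := ih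
      have h3 := hσ (i + t + 1)
      rw [h2] at h3
      have h4 := h _ h1
      push_cast
      rw [← add_assoc]
      rcases step_false h3 with ⟨h5, h6⟩ | h5
      · refine ⟨h1, ?_, h6⟩
        by_contra h7
        rw [h5, if_neg h7] at h4
        simp only [Fin.val_one] at h4
        split_ifs at h4 <;> omega
      · rw [h5] at h4
        simp only [Fin.val_two] at h4
        split_ifs at h4 <;> omega
  have := (key (n - 1)).1
  rw [Nat.cast_sub NeZero.one_le] at this
  simp at this
  exact hi' (by rwa [sub_eq_add_neg])

theorem isGood_of_forall_exists_card_le [NeZero n] {c : ZMod n → Fin 3}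
    (h : ∀ S : Finset (ZMod n), S.Nonempty →
      ∃ i ∈ S, (if i + 1 ∈ S then 1 else 0) + (if i - 1 ∈ S then 1 else 0) ≤ (c i : ℕ)) :
    IsGood c := by
  classical
  have huniv : ∃ i, 2 ≤ (c i : ℕ) := by
    obtain ⟨i, -, hi⟩ := h Finset.univ Finset.univ_nonempty
    exact ⟨i, by simpa using hi⟩
  -- The state before `i` is `false` exactly when, reading backwards from `i - 1`, a possibly empty
  -- run of 1s ends in a 0.
  refine ⟨?_, fun i => !decide (∃ t : ℕ, c (i - 1 - t) = 0 ∧ ∀ u < t, c (i - 1 - u) = 1), ?_⟩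
  · rintro rfl
    obtain ⟨i, hi⟩ := huniv
    simp at hi
  intro i
  have hsucc : (∃ t : ℕ, c (i + 1 - 1 - t) = 0 ∧ ∀ u < t, c (i + 1 - 1 - u) = 1) ↔
      c i = 0 ∨ c i = 1 ∧ ∃ t : ℕ, c (i - 1 - t) = 0 ∧ ∀ u < t, c (i - 1 - u) = 1 := by
    have hshift : ∀ t : ℕ, i - ((t + 1 : ℕ) : ZMod n) = i - 1 - t := fun t => by
      push_cast; ring
    rw [add_sub_cancel_right]
    constructor
    · rintro ⟨_ | t, h1, h2⟩
      · exact Or.inl (by simpa using h1)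
      · refine Or.inr ⟨by simpa using h2 0 (by omega), t, by rwa [← hshift], fun u hu => ?_⟩
        rw [← hshift]
        exact h2 _ (by omega)
    · rintro (h0 | ⟨h1, t, h2, h3⟩)
      · exact ⟨0, by simpa using h0, by simp⟩
      · refine ⟨t + 1, by rwa [hshift], ?_⟩
        rintro (_ | u) hu
        · simpa using h1
        · rw [hshift]
          exact h3 u (by omega)
  -- Two 0s joined by 1s form a forbidden segment. It may wrap round the cycle onto the same 0: only
  -- the presence of neighbours in it is used.
  have hzero : c i = 0 → ¬ ∃ t : ℕ, c (i - 1 - t) = 0 ∧ ∀ u < t, c (i - 1 - u) = 1 := by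
    rintro h0 ⟨t, ht, hu⟩
    obtain ⟨j, hj, hle⟩ := h ((Finset.range (t + 2)).image fun u : ℕ => i - u)
      (by simp)
    obtain ⟨u, hu', rfl⟩ := Finset.mem_image.1 hj
    have hmem : ∀ v : ℕ, v < t + 2 → i - v ∈ (Finset.range (t + 2)).image fun u : ℕ => i - u :=
      fun v hv => Finset.mem_image.2 ⟨v, Finset.mem_range.2 hv, rfl⟩
    rw [Finset.mem_range] at hu'
    have hlow : ∀ v : ℕ, v + 1 < t + 2 →
        i - v - 1 ∈ (Finset.range (t + 2)).image fun u : ℕ => i - u := fun v hv => by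
      have := hmem (v + 1) hv
      push_cast at this
      rwa [← sub_sub] at this
    rcases u with _ | u
    · have hz : c (i - ((0 : ℕ) : ZMod n)) = 0 := by simpa using h0
      rw [if_pos (hlow 0 (by omega)), hz] at hle
      simp at hle
    · have hhigh : i - ((u + 1 : ℕ) : ZMod n) + 1
          ∈ (Finset.range (t + 2)).image fun u : ℕ => i - u := by
        have := hmem u (by omega)
        push_cast
        rwa [show i - ((u : ZMod n) + 1) + 1 = i - u by ring]
      rw [if_pos hhigh] at hle
      have heq : i - ((u + 1 : ℕ) : ZMod n) = i - 1 - u := by push_cast; ring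
      rcases (show u < t ∨ u = t by omega) with hlt | rfl
      · rw [if_pos (hlow _ (by omega)), heq, hu u hlt] at hle
        simp at hle
      · rw [heq, ht] at hle
        simp at hle
  simp only [hsucc]
  have h3 : c i = 0 ∨ c i = 1 ∨ c i = 2 := by
    generalize c i = a
    revert a; decide
  rcases h3 with h3 | h3 | h3
  · rw [h3, step_zero]
    simpa using hzero h3
  · rw [h3, step_one]
    simp
  · rw [h3, step_two]
    simp

/-- The good words are the words of recurrent sandpiles: no set of vertices is a forbidden
subconfiguration. -/
theorem isGood_iff [NeZero n] {c : ZMod n → Fin 3} :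
    IsGood c ↔ ∀ S : Finset (ZMod n), S.Nonempty →
      ∃ i ∈ S, (if i + 1 ∈ S then 1 else 0) + (if i - 1 ∈ S then 1 else 0) ≤ (c i : ℕ) :=
  ⟨fun h _ hS => h.exists_card_le hS, isGood_of_forall_exists_card_le⟩

theorem IsGood.comp_add {c : ZMod n → Fin 3} (hc : IsGood c) (k : ZMod n) :
    IsGood fun i => c (i + k) := by
  obtain ⟨hne, σ, hσ⟩ := hc
  refine ⟨fun h => hne (funext fun i => ?_), fun i => σ (i + k), fun i => ?_⟩
  · simpa using congrFun h (i - k)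
  · rw [hσ (i + k), add_right_comm]

theorem isGood_comp_add_iff {c : ZMod n → Fin 3} (k : ZMod n) :
    IsGood (fun i => c (i + k)) ↔ IsGood c := by
  refine ⟨fun h => ?_, fun h => h.comp_add k⟩
  simpa using h.comp_add (-k)

end Words

/-! ### The transfer matrix and Fibonacci counts of good words -/

section Counting

/-- Distributivity over an ordered product, since the transfer matrices do not commute. -/
theorem sum_piFinset_prod_ofFn {R α : Type*} [Semiring R] [DecidableEq α] {n : ℕ}
    (L : Fin n → Finset α) (f : α → R) :
    ∑ c ∈ Fintype.piFinset L, (List.ofFn fun i => f (c i)).prod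
      = (List.ofFn fun i => ∑ a ∈ L i, f a).prod := by
  induction n with
  | zero => simp
  | succ n ih =>
    rw [List.ofFn_succ, List.prod_cons, ← ih (fun i => L i.succ), Finset.sum_mul_sum,
      ← Finset.sum_product']
    refine Finset.sum_nbij' (fun c => (c 0, Fin.tail c)) (fun p => Fin.cons p.1 p.2) ?_ ?_ ?_ ?_ ?_
    · intro c hc
      simp only [Fintype.mem_piFinset, Finset.mem_product] at hc ⊢
      exact ⟨hc 0, fun i => hc i.succ⟩
    · intro p hp
      simp only [Fintype.mem_piFinset, Finset.mem_product] at hp ⊢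
      exact Fin.cases hp.1 hp.2
    · intro c _
      simp
    · intro p _
      simp
    · intro c _
      simp [List.ofFn_succ, Fin.tail]

/-- The transition matrix of a letter. -/
def letterMatrix (a : Fin 3) : Matrix Bool Bool ℕ :=
  Matrix.of fun s u => if step a s = some u then 1 else 0

-- The automaton is deterministic, so a word has at most one path from a given state and the entry
-- is 0 or 1. Values of `σ` beyond `n` are irrelevant, hence existence and not a count.
open Classical in
theorem prod_letterMatrix_apply {n : ℕ} (c : Fin n → Fin 3) (s u : Bool) :
    (List.ofFn fun i => letterMatrix (c i)).prod s u =
      if ∃ σ : ℕ → Bool, σ 0 = s ∧ σ n = u ∧ ∀ i : Fin n, step (c i) (σ i) = some (σ (i + 1))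
      then 1 else 0 := by
  induction n generalizing s with
  | zero =>
    simp only [List.ofFn_zero, List.prod_nil, Matrix.one_apply, IsEmpty.forall_iff, and_true]
    congr 1
    refine propext ⟨fun h => ⟨fun _ => s, rfl, h⟩, ?_⟩
    rintro ⟨σ, rfl, rfl⟩
    rfl
  | succ n ih =>
    rw [List.ofFn_succ, List.prod_cons, Matrix.mul_apply]
    simp only [ih]
    simp only [letterMatrix, Matrix.of_apply]
    rcases hstep : step (c 0) s with _ | v
    · simp only [reduceCtorEq, if_false, zero_mul, Finset.sum_const_zero]
      rw [if_neg]
      rintro ⟨σ, rfl, -, h⟩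
      have := h 0
      simp [hstep] at this
    · simp only [Option.some.injEq, ite_mul, one_mul, zero_mul, Finset.sum_ite_eq, Finset.mem_univ,
        if_true]
      congr 1
      refine propext ⟨?_, ?_⟩
      · rintro ⟨σ, h0, hn, h⟩
        refine ⟨fun t => Nat.casesOn t s σ, rfl, hn, Fin.cases ?_ ?_⟩
        · simpa [h0] using hstep
        · intro i
          simpa using h i
      · rintro ⟨σ, h0, hn, h⟩
        refine ⟨fun t => σ (t + 1), ?_, hn, fun i => by simpa using h i.succ⟩
        have := h 0
        simp only [Fin.val_zero, h0, hstep, Option.some.injEq] at this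
        exact this.symm

variable {n : ℕ} [NeZero n]

theorem exists_path_iff_exists_isTrack (c : ZMod n → Fin 3) (s : Bool) :
    (∃ σ : ℕ → Bool, σ 0 = s ∧ σ n = s ∧
      ∀ i : Fin n, step (c (i : ℕ)) (σ i) = some (σ (i + 1))) ↔
    ∃ σ, IsTrack c σ ∧ σ 0 = s := by
  constructor
  · rintro ⟨σ, h0, hn, h⟩
    refine ⟨fun i => σ i.val, fun i => ?_, by simpa using h0⟩
    have := h ⟨i.val, ZMod.val_lt i⟩
    simp only [ZMod.natCast_zmod_val] at this
    rw [this]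
    congr 1
    change σ (i.val + 1) = σ (i + 1).val
    rcases (Nat.succ_le_of_lt (ZMod.val_lt i)).lt_or_eq with hlt | heq
    · have h1 : i + 1 = ((i.val + 1 : ℕ) : ZMod n) := by simp
      rw [h1, ZMod.val_natCast_of_lt hlt]
    · have h1 : i + 1 = 0 := by
        rw [← ZMod.natCast_zmod_val i, ← Nat.cast_succ, heq, ZMod.natCast_self]
      rw [h1, ZMod.val_zero, h0, ← hn]
      exact congrArg σ heq
  · rintro ⟨σ, hσ, h0⟩
    refine ⟨fun t => σ t, by simpa using h0, by simpa using h0, fun i => ?_⟩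
    simpa using hσ i

-- The trace counts cyclic runs: one for a good word, two for the constant word 1, none otherwise.
open Classical in
theorem trace_prod_letterMatrix (c : ZMod n → Fin 3) :
    (List.ofFn fun i : Fin n => letterMatrix (c (i : ℕ))).prod.trace =
      (if IsGood c then 1 else 0) + if c = 1 then 2 else 0 := by
  simp only [Matrix.trace, Matrix.diag_apply, Fintype.sum_bool, prod_letterMatrix_apply,
    exists_path_iff_exists_isTrack]
  by_cases hc : c = 1
  · subst hc
    have hex : ∀ s, ∃ σ, IsTrack (1 : ZMod n → Fin 3) σ ∧ σ 0 = s :=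
      fun s => ⟨fun _ => s, fun _ => by simp [step_one], rfl⟩
    have hgood : ¬ IsGood (1 : ZMod n → Fin 3) := fun h => h.1 rfl
    rw [if_pos (hex _), if_pos (hex _), if_neg hgood, if_pos rfl]
  · rw [if_neg hc, add_zero]
    have hnot : ¬ ((∃ σ, IsTrack c σ ∧ σ 0 = true) ∧ ∃ σ, IsTrack c σ ∧ σ 0 = false) := by
      rintro ⟨⟨σ, h1, h2⟩, τ, h3, h4⟩
      exact hc (h1.eq_one_of_ne h3 (by simp [h2, h4]))
    have hiff : IsGood c ↔ (∃ σ, IsTrack c σ ∧ σ 0 = true) ∨ ∃ σ, IsTrack c σ ∧ σ 0 = false := by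
      constructor
      · rintro ⟨-, σ, h⟩
        cases h0 : σ 0
        · exact Or.inr ⟨σ, h, h0⟩
        · exact Or.inl ⟨σ, h, h0⟩
      · rintro (⟨σ, h, -⟩ | ⟨σ, h, -⟩) <;> exact ⟨hc, σ, h⟩
    rw [if_congr hiff rfl rfl]
    by_cases h1 : ∃ σ, IsTrack c σ ∧ σ 0 = true
    · rw [if_pos h1, if_neg fun h2 => hnot ⟨h1, h2⟩, if_pos (Or.inl h1)]
    · by_cases h2 : ∃ σ, IsTrack c σ ∧ σ 0 = false
      · rw [if_neg h1, if_pos h2, if_pos (Or.inr h2)]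
      · rw [if_neg h1, if_neg h2, if_neg (not_or.2 ⟨h1, h2⟩)]

open Classical in
/-- The transfer matrix method for good words whose letters are restricted to given sets. -/
theorem card_isGood_add (L : ℕ → Finset (Fin 3)) :
    (Finset.univ.filter fun c : ZMod n → Fin 3 =>
        IsGood c ∧ ∀ i, c i ∈ L i.val).card + (if ∀ i < n, 1 ∈ L i then 2 else 0)
      = ((List.range n).map fun i => ∑ a ∈ L i, letterMatrix a).prod.trace := by
  have hofFn : ((List.range n).map fun i => ∑ a ∈ L i, letterMatrix a)
      = List.ofFn fun i : Fin n => ∑ a ∈ L i, letterMatrix a := by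
    rw [List.ofFn_eq_map, ← List.map_coe_finRange_eq_range, List.map_map]
    rfl
  rw [hofFn, ← sum_piFinset_prod_ofFn, Matrix.trace_sum]
  have hbij : ∑ c ∈ Fintype.piFinset fun i : Fin n => L i,
        (List.ofFn fun i => letterMatrix (c i)).prod.trace
      = ∑ c ∈ Finset.univ.filter (fun c : ZMod n → Fin 3 => ∀ i, c i ∈ L i.val),
        (List.ofFn fun i : Fin n => letterMatrix (c (i : ℕ))).prod.trace := by
    symm
    refine Finset.sum_nbij' (fun c i => c (i : ℕ)) (fun c i => c ⟨i.val, ZMod.val_lt i⟩)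
      ?_ ?_ ?_ ?_ ?_
    · intro c hc
      simp only [Finset.mem_filter, Finset.mem_univ, true_and, Fintype.mem_piFinset] at hc ⊢
      intro i
      have := hc (i : ℕ)
      rwa [ZMod.val_natCast_of_lt i.2] at this
    · intro c hc
      simp only [Finset.mem_filter, Finset.mem_univ, true_and, Fintype.mem_piFinset] at hc ⊢
      exact fun i => hc ⟨i.val, ZMod.val_lt i⟩
    · intro c _
      funext i
      simp
    · intro c _
      funext i
      simp [ZMod.val_natCast_of_lt i.2]
    · intro c _
      rfl
  rw [hbij]
  simp only [trace_prod_letterMatrix]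
  rw [Finset.sum_add_distrib, ← Finset.card_filter, Finset.filter_filter]
  congr 1
  · simp only [and_comm]
  -- The constant word 1 obeys the restrictions iff every `L i` with `i < n` contains 1.
  · rw [Finset.sum_ite_eq']
    refine if_congr ?_ rfl rfl
    simp only [Finset.mem_filter, Finset.mem_univ, true_and, Pi.one_apply]
    refine ⟨fun h i => h _ (ZMod.val_lt i), fun h i hi => ?_⟩
    have := h (i : ℕ)
    rwa [ZMod.val_natCast_of_lt hi] at this

theorem fib_step (r : ℕ) : Nat.fib (2 * (r + 1)) = Nat.fib (2 * r) + Nat.fib (2 * r + 1) ∧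
    Nat.fib (2 * (r + 1) + 1) = Nat.fib (2 * r) + 2 * Nat.fib (2 * r + 1) := by
  have h1 : Nat.fib (2 * r + 2) = Nat.fib (2 * r) + Nat.fib (2 * r + 1) := Nat.fib_add_two
  have h2 : Nat.fib (2 * r + 1 + 2) = Nat.fib (2 * r + 1) + Nat.fib (2 * r + 1 + 1) :=
    Nat.fib_add_two
  rw [show 2 * (r + 1) = 2 * r + 2 by ring, show 2 * r + 2 + 1 = 2 * r + 1 + 2 by ring, h2, h1]
  exact ⟨rfl, by ring⟩

/-- The matrix is `!![2, 1; 1, 1]`, the square of the Fibonacci matrix. The last entry would be `fib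
(2r - 1)`; the additive form also covers `r = 0`. -/
theorem sum_univ_letterMatrix_pow (r : ℕ) :
    ((∑ a, letterMatrix a) ^ r) true true = Nat.fib (2 * r + 1) ∧
    ((∑ a, letterMatrix a) ^ r) true false = Nat.fib (2 * r) ∧
    ((∑ a, letterMatrix a) ^ r) false true = Nat.fib (2 * r) ∧
    ((∑ a, letterMatrix a) ^ r) false false + Nat.fib (2 * r) = Nat.fib (2 * r + 1) := by
  induction r with
  | zero => simp
  | succ r ih =>
    obtain ⟨h1, h2, h3, h4⟩ := ih
    obtain ⟨f1, f2⟩ := fib_step r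
    have e1 : (∑ a, letterMatrix a) true true = 2 := by decide
    have e2 : (∑ a, letterMatrix a) true false = 1 := by decide
    have e3 : (∑ a, letterMatrix a) false true = 1 := by decide
    have e4 : (∑ a, letterMatrix a) false false = 1 := by decide
    simp only [pow_succ, Matrix.mul_apply, Fintype.sum_bool, e1, e2, e3, e4, f1, f2]
    omega

-- The `+ 2` is the contribution of the constant word 1 to the trace.
open Classical in
theorem card_isGood_apply_zero_ne_two :
    (Finset.univ.filter fun c : ZMod n → Fin 3 => IsGood c ∧ c 0 ≠ 2).card + 2
      = 2 * Nat.fib (2 * n - 1) := by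
  have h := card_isGood_add (n := n) fun t => if t = 0 then {0, 1} else Finset.univ
  rw [if_pos (by intro i _; split_ifs <;> decide)] at h
  have hset : (Finset.univ.filter fun c : ZMod n → Fin 3 => IsGood c ∧ c 0 ≠ 2)
      = Finset.univ.filter fun c : ZMod n → Fin 3 =>
        IsGood c ∧ ∀ i, c i ∈ (if i.val = 0 then {0, 1} else Finset.univ : Finset (Fin 3)) := by
    ext c
    have hletter : ∀ a : Fin 3, a ≠ 2 ↔ a ∈ ({0, 1} : Finset (Fin 3)) := by decide
    simp only [Finset.mem_filter, Finset.mem_univ, true_and, hletter]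
    refine and_congr_right fun _ => ⟨fun h i => ?_, fun h => by simpa using h 0⟩
    split_ifs with hi
    · rwa [(ZMod.val_eq_zero i).1 hi]
    · exact Finset.mem_univ _
  rw [hset, h]
  obtain ⟨r, rfl⟩ : ∃ r, n = 1 + r := ⟨n - 1, by have := NeZero.one_le (n := n); omega⟩
  rw [List.range_add, List.map_append, List.prod_append, List.map_map,
    List.map_eq_replicate_iff (l := List.range r) (b := ∑ a, letterMatrix a) |>.2 (by simp)]
  obtain ⟨h1, h2, h3, h4⟩ := sum_univ_letterMatrix_pow r
  have e1 : (∑ a ∈ ({0, 1} : Finset (Fin 3)), letterMatrix a) true true = 1 := by decide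
  have e2 : (∑ a ∈ ({0, 1} : Finset (Fin 3)), letterMatrix a) true false = 1 := by decide
  have e3 : (∑ a ∈ ({0, 1} : Finset (Fin 3)), letterMatrix a) false true = 0 := by decide
  have e4 : (∑ a ∈ ({0, 1} : Finset (Fin 3)), letterMatrix a) false false = 1 := by decide
  rw [show 2 * (1 + r) - 1 = 2 * r + 1 by omega]
  simp only [List.length_range, List.prod_replicate, List.range_one, List.map_cons, List.map_nil,
    List.prod_singleton, if_true, Matrix.trace, Matrix.diag_apply, Fintype.sum_bool,
    Matrix.mul_apply, e1, e2, e3, e4]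
  omega

open Classical in
theorem card_isGood_maximal_arc {m : ℕ} (hm : 1 ≤ m) (hmn : m + 2 ≤ n) :
    (Finset.univ.filter fun c : ZMod n → Fin 3 => IsGood c ∧
      (∀ t < m, c (t : ℕ) = 2) ∧ c (m : ℕ) ≠ 2 ∧ c (-1) ≠ 2).card = Nat.fib (2 * (n - m)) := by
  have h := card_isGood_add (n := n) fun t =>
    if t < m then {2} else if t = m ∨ t = n - 1 then {0, 1} else Finset.univ
  rw [if_neg (by
    intro h
    have := h 0 (by omega)
    rw [if_pos (by omega)] at this
    revert this; decide), add_zero] at h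
  have hset : (Finset.univ.filter fun c : ZMod n → Fin 3 => IsGood c ∧
      (∀ t < m, c (t : ℕ) = 2) ∧ c (m : ℕ) ≠ 2 ∧ c (-1) ≠ 2)
      = Finset.univ.filter fun c : ZMod n → Fin 3 =>
        IsGood c ∧ ∀ i, c i ∈ (if i.val < m then {2} else
          if i.val = m ∨ i.val = n - 1 then {0, 1} else Finset.univ : Finset (Fin 3)) := by
    ext c
    have hletter : ∀ a : Fin 3, a ≠ 2 ↔ a ∈ ({0, 1} : Finset (Fin 3)) := by decide
    have hneg : (-1 : ZMod n) = ((n - 1 : ℕ) : ZMod n) := by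
      rw [Nat.cast_sub NeZero.one_le]
      simp
    simp only [Finset.mem_filter, Finset.mem_univ, true_and, hletter, hneg]
    refine and_congr_right fun _ => ⟨fun ⟨h1, h2, h3⟩ i => ?_, fun h => ⟨fun t ht => ?_, ?_, ?_⟩⟩
    · split_ifs with hi hi
      · rw [Finset.mem_singleton, ← h1 _ hi, ZMod.natCast_zmod_val]
      · rcases hi with hi | hi
        · rwa [← hi, ZMod.natCast_zmod_val] at h2
        · rwa [← hi, ZMod.natCast_zmod_val] at h3
      · exact Finset.mem_univ _
    · have := h (t : ℕ)
      rwa [ZMod.val_natCast_of_lt (by omega), if_pos ht, Finset.mem_singleton] at this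
    · have := h (m : ℕ)
      rwa [ZMod.val_natCast_of_lt (by omega), if_neg (by omega), if_pos (by omega)] at this
    · have := h ((n - 1 : ℕ) : ZMod n)
      rwa [ZMod.val_natCast_of_lt (by omega), if_neg (by omega), if_pos (by omega)] at this
  rw [hset, h]
  -- The word splits into the arc, a border letter, `r` free letters and a second border letter,
  -- distinct from the first because `m + 2 ≤ n`.
  obtain ⟨r, hr⟩ : ∃ r, n = m + (1 + (r + 1)) := ⟨n - m - 2, by omega⟩
  rw [hr]
  simp only [List.range_add, List.map_append, List.prod_append, List.map_map]
  rw [List.map_eq_replicate_iff (b := letterMatrix 2) |>.2 (by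
      intro t ht
      rw [List.mem_range] at ht
      simp [ht]),
    List.map_eq_replicate_iff (l := List.range r) (b := ∑ a, letterMatrix a) |>.2 (by
      intro t ht
      rw [List.mem_range] at ht
      simp only [Function.comp_apply]
      rw [if_neg (by omega), if_neg (by omega)])]
  obtain ⟨h1, h2, h3, h4⟩ := sum_univ_letterMatrix_pow r
  have e1 : (∑ a ∈ ({0, 1} : Finset (Fin 3)), letterMatrix a) true true = 1 := by decide
  have e2 : (∑ a ∈ ({0, 1} : Finset (Fin 3)), letterMatrix a) true false = 1 := by decide
  have e3 : (∑ a ∈ ({0, 1} : Finset (Fin 3)), letterMatrix a) false true = 0 := by decide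
  have e4 : (∑ a ∈ ({0, 1} : Finset (Fin 3)), letterMatrix a) false false = 1 := by decide
  have g1 : letterMatrix 2 true true = 1 := by decide
  have g2 : letterMatrix 2 true false = 0 := by decide
  have g3 : letterMatrix 2 false true = 1 := by decide
  have g4 : letterMatrix 2 false false = 0 := by decide
  -- A 2 resets the state whatever it was, so a block of 2s acts like a single one.
  have hpow : letterMatrix 2 ^ m = letterMatrix 2 := by
    obtain ⟨k, rfl⟩ : ∃ k, m = k + 1 := ⟨m - 1, by omega⟩
    exact IsIdempotentElem.pow_succ_eq k (by unfold IsIdempotentElem; decide)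
  obtain ⟨f1, f2⟩ := fib_step r
  obtain ⟨f3, f4⟩ := fib_step (r + 1)
  rw [show m + (1 + (r + 1)) - m = r + 1 + 1 by omega, f3, f1, f2]
  have hlast : ¬ m + (1 + (r + 1)) - 1 < m := by omega
  simp only [List.length_range, List.prod_replicate, List.range_one, List.map_cons, List.map_nil,
    List.prod_singleton, Function.comp_apply, add_zero, true_or, or_true, lt_irrefl, if_false, hlast,
    if_true, show m + (1 + r) = m + (1 + (r + 1)) - 1 by omega, hpow,
    Matrix.trace, Matrix.diag_apply, Fintype.sum_bool,
    Matrix.mul_apply, e1, e2, e3, e4, g1, g2, g3, g4]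
  omega

end Counting

/-! ### Avalanches on the wheel -/

section Wheel

variable {n : ℕ}

theorem add_one_ne_sub_one (hn : 3 ≤ n) (i : ZMod n) : i + 1 ≠ i - 1 := by
  intro h
  have h2 : ((2 : ℕ) : ZMod n) = 0 := by
    push_cast
    linear_combination h
  rw [ZMod.natCast_eq_zero_iff] at h2
  have := Nat.le_of_dvd (by norm_num) h2
  omega

theorem adj_sink (v : {v : Option (Fin n) // v ≠ none}) : (wheelGraph n).Adj v.1 none := by
  obtain ⟨_ | i, hi⟩ := v
  · exact absurd rfl hi
  · trivial

theorem injOn_add_natCast (i : ZMod n) {m : ℕ} (hm : m ≤ n) :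
    Set.InjOn (fun t : ℕ => i + (t : ZMod n)) (Finset.range m) := by
  intro t ht u hu h
  simp only [Finset.coe_range, Set.mem_Iio] at ht hu
  have := congrArg ZMod.val (add_left_cancel h)
  rwa [ZMod.val_natCast_of_lt (by omega), ZMod.val_natCast_of_lt (by omega)] at this

variable [NeZero n]

/-- The non-sink vertices of the wheel, indexed by the integers modulo `n`. -/
def rimVertex (n : ℕ) [NeZero n] : ZMod n ≃ {v : Option (Fin n) // v ≠ none} where
  toFun i := ⟨some ⟨i.val, ZMod.val_lt i⟩, Option.some_ne_none _⟩
  invFun v := ((v.1.get (Option.isSome_iff_ne_none.2 v.2)).val : ZMod n)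
  left_inv i := by simp
  right_inv v := by
    obtain ⟨_ | i, hi⟩ := v
    · exact absurd rfl hi
    · simp [ZMod.val_natCast_of_lt i.2]

theorem cycleGraph_adj_iff (hn : 3 ≤ n) (i j : ZMod n) :
    (SimpleGraph.cycleGraph n).Adj ⟨i.val, ZMod.val_lt i⟩ ⟨j.val, ZMod.val_lt j⟩ ↔
      i = j + 1 ∨ i = j - 1 := by
  have hsub : ∀ i j : ZMod n,
      ((⟨i.val, ZMod.val_lt i⟩ : Fin n) - ⟨j.val, ZMod.val_lt j⟩).val = 1 ↔ i - j = 1 := by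
    intro i j
    have hcast : ((((⟨i.val, ZMod.val_lt i⟩ : Fin n) - ⟨j.val, ZMod.val_lt j⟩).val : ℕ) : ZMod n)
        = i - j := by
      rw [Fin.val_sub, ZMod.natCast_mod, Nat.cast_add, Nat.cast_sub (ZMod.val_lt j).le]
      simp only [CharP.cast_eq_zero, ZMod.natCast_zmod_val]
      ring
    rw [← hcast]
    constructor
    · intro h
      rw [h, Nat.cast_one]
    · intro h
      have : Fact (1 < n) := ⟨by omega⟩
      have hval := congrArg ZMod.val h
      rwa [ZMod.val_natCast_of_lt (Fin.is_lt _), ZMod.val_one] at hval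
  rw [SimpleGraph.cycleGraph_adj', hsub, hsub]
  refine or_congr ⟨fun h => ?_, fun h => ?_⟩ ⟨fun h => ?_, fun h => ?_⟩
  · rw [← h]; ring
  · rw [h]; ring
  · rw [← h]; ring
  · rw [h]; ring

theorem wheelGraph_adj_rimVertex (hn : 3 ≤ n) (i j : ZMod n) :
    (wheelGraph n).Adj (rimVertex n i).1 (rimVertex n j).1 ↔ i = j + 1 ∨ i = j - 1 :=
  cycleGraph_adj_iff hn i j

theorem card_filter_adj_rimVertex (hn : 3 ≤ n) (T : Finset (ZMod n)) (i : ZMod n) :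
    ((T.map (rimVertex n).toEmbedding).filter
      fun w => (wheelGraph n).Adj w.1 (rimVertex n i).1).card
      = (if i + 1 ∈ T then 1 else 0) + if i - 1 ∈ T then 1 else 0 := by
  rw [Finset.card_filter, Finset.sum_map]
  simp only [Equiv.coe_toEmbedding, wheelGraph_adj_rimVertex hn]
  have hsplit : ∀ j : ZMod n, (if j = i + 1 ∨ j = i - 1 then 1 else 0)
      = (if j = i + 1 then 1 else 0) + if j = i - 1 then 1 else 0 := by
    intro j
    by_cases h1 : j = i + 1
    · subst h1
      simp [add_one_ne_sub_one hn i]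
    · simp [h1]
  simp only [hsplit, Finset.sum_add_distrib, Finset.sum_ite_eq']

theorem degree_rimVertex (hn : 3 ≤ n) (i : ZMod n) : (wheelGraph n).degree (rimVertex n i).1 = 3 := by
  have hadj : (wheelGraph n).Adj (rimVertex n i).1 none := trivial
  rw [degree_eq_card_add, if_pos hadj, ← Finset.map_univ_equiv (rimVertex n),
    card_filter_adj_rimVertex hn]
  simp

/-- The sandpile on the wheel given by a cyclic word. -/
def wordSandpile (w : ZMod n → Fin 3) : Sandpile (none : Option (Fin n)) :=
  fun v => (w ((rimVertex n).symm v) : ℕ)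

@[simp]
theorem wordSandpile_rimVertex (w : ZMod n → Fin 3) (i : ZMod n) :
    wordSandpile w (rimVertex n i) = (w i : ℕ) := by
  simp [wordSandpile]

theorem exists_map_rimVertex (S : Finset {v : Option (Fin n) // v ≠ none}) :
    ∃ S' : Finset (ZMod n), S = S'.map (rimVertex n).toEmbedding :=
  ⟨S.map (rimVertex n).symm.toEmbedding, by ext; simp⟩

theorem isRecurrent_wordSandpile_iff (hn : 3 ≤ n) (w : ZMod n → Fin 3) :
    IsRecurrent (wheelGraph n) (wordSandpile w) ↔ IsGood w := by
  have hstable : IsStable (wheelGraph n) (wordSandpile w) := by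
    rw [IsStable, (rimVertex n).surjective.forall]
    intro i
    rw [degree_rimVertex hn, wordSandpile_rimVertex]
    exact (w i).2
  rw [isRecurrent_iff_of_forall_adj adj_sink, isGood_iff, and_iff_right hstable]
  constructor
  · intro h S hS
    obtain ⟨v, hv, hle⟩ := h (S.map (rimVertex n).toEmbedding) (by simpa using hS)
    obtain ⟨i, hi, rfl⟩ := Finset.mem_map.1 hv
    refine ⟨i, hi, ?_⟩
    simpa [card_filter_adj_rimVertex hn] using hle
  · intro h S hS
    obtain ⟨S, rfl⟩ := exists_map_rimVertex S
    obtain ⟨i, hi, hle⟩ := h S (by simpa using hS)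
    refine ⟨rimVertex n i, by simpa using hi, ?_⟩
    simpa [card_filter_adj_rimVertex hn] using hle

open Classical in
theorem sum_recurrents_wheelGraph (hn : 3 ≤ n) {R : Type*} [AddCommMonoid R]
    (F : Sandpile (none : Option (Fin n)) → R) :
    ∑ c ∈ recurrents (wheelGraph n) none, F c
      = ∑ w ∈ Finset.univ.filter (fun w : ZMod n → Fin 3 => IsGood w), F (wordSandpile w) := by
  symm
  refine Finset.sum_bij (fun w _ => wordSandpile w) ?_ ?_ ?_ (fun _ _ => rfl)
  · intro w hw
    rw [mem_recurrents, isRecurrent_wordSandpile_iff hn]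
    simpa using hw
  · intro w _ w' _ h
    funext i
    have := congrFun h (rimVertex n i)
    exact Fin.ext (by simpa using this)
  · intro c hc
    rw [mem_recurrents] at hc
    have hlt : ∀ i, c (rimVertex n i) < 3 := fun i => by
      have := hc.1 (rimVertex n i)
      rwa [degree_rimVertex hn] at this
    have heq : wordSandpile (fun i => ⟨c (rimVertex n i), hlt i⟩) = c := by
      funext v
      simp [wordSandpile]
    refine ⟨fun i => ⟨c (rimVertex n i), hlt i⟩, ?_, heq⟩
    rw [← heq, isRecurrent_wordSandpile_iff hn] at hc
    simpa using hc

theorem avalancheMonomial_wordSandpile (hn : 3 ≤ n) (w : ZMod n → Fin 3) (k : ZMod n)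
    (T : Finset (ZMod n))
    (hT : ∀ S ⊆ T, S.Nonempty → ∃ i ∈ S, 3 ≤ (w i : ℕ) + (if i = k then 1 else 0)
      + ((if i + 1 ∈ T \ S then 1 else 0) + if i - 1 ∈ T \ S then 1 else 0))
    (hstable : ∀ i, (w i : ℕ) + (if i = k then 1 else 0)
      + ((if i + 1 ∈ T then 1 else 0) + if i - 1 ∈ T then 1 else 0)
      < 3 + if i ∈ T then 3 else 0) :
    avalancheMonomial (wheelGraph n) (wordSandpile w) (rimVertex n k)
      = ∏ i ∈ T, MvPolynomial.X (rimVertex n i) := by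
  have happly : ∀ i, (wordSandpile w + Pi.single (rimVertex n k) 1 : Sandpile none) (rimVertex n i)
      = (w i : ℕ) + if i = k then 1 else 0 := by
    intro i
    simp [Pi.single_apply]
  rw [avalancheMonomial, topplingVector_eq_indicator _ (T.map (rimVertex n).toEmbedding)]
  · simp only [pow_ite, pow_one, pow_zero, Finset.prod_ite_mem, Finset.univ_inter, Finset.prod_map,
      Equiv.coe_toEmbedding]
  · intro S hST hS
    obtain ⟨S, rfl⟩ := exists_map_rimVertex S
    rw [Finset.map_subset_map] at hST
    obtain ⟨i, hi, hle⟩ := hT S hST (by simpa using hS)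
    refine ⟨rimVertex n i, by simpa using hi, ?_⟩
    rw [degree_rimVertex hn, happly, ← Finset.map_sdiff, card_filter_adj_rimVertex hn]
    exact hle
  · rw [(rimVertex n).surjective.forall]
    intro i
    rw [degree_rimVertex hn, happly, card_filter_adj_rimVertex hn]
    simpa using hstable i

theorem avalancheMonomial_of_ne_two (hn : 3 ≤ n) {w : ZMod n → Fin 3} {k : ZMod n} (hk : w k ≠ 2) :
    avalancheMonomial (wheelGraph n) (wordSandpile w) (rimVertex n k) = 1 := by
  rw [avalancheMonomial_wordSandpile hn w k ∅]
  · simp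
  · intro S hS hS'
    rw [Finset.subset_empty.1 hS] at hS'
    simp at hS'
  · intro i
    simp only [Finset.notMem_empty, if_false, add_zero]
    by_cases hik : i = k
    · subst hik
      have := (w i).2
      have h2 : (w i : ℕ) ≠ 2 := fun h => hk (Fin.ext h)
      simp only [if_true]
      omega
    · rw [if_neg hik]
      exact (w i).2

/-- All letters are `2`, except that one of them may be `1`. -/
def IsFull (w : ZMod n → Fin 3) : Prop :=
  ∃ j, (∀ i, i ≠ j → w i = 2) ∧ w j ≠ 0

theorem avalancheMonomial_of_isFull (hn : 3 ≤ n) {w : ZMod n → Fin 3} {k : ZMod n} (hk : w k = 2)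
    (hw : IsFull w) : avalancheMonomial (wheelGraph n) (wordSandpile w) (rimVertex n k)
      = ∏ i, MvPolynomial.X (rimVertex n i) := by
  classical
  rw [avalancheMonomial_wordSandpile hn w k Finset.univ]
  · intro S _ hS
    by_cases hkS : k ∈ S
    · exact ⟨k, hkS, by simp [hk]⟩
    obtain ⟨j, hj, hj0⟩ := hw
    obtain ⟨p, hp⟩ := hS
    -- Let `u` and `v` be the first vertices of `S` met from `k` in the two directions; each has a
    -- toppled neighbour, which suffices if its letter is 2. If both are the exceptional vertex `j`,
    -- both neighbours of `j` have toppled and its letter 1 or 2 suffices.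
    have hex : ∃ t : ℕ, k + t ∈ S := ⟨(p - k).val, by simpa using hp⟩
    have hex' : ∃ t : ℕ, k - t ∈ S := ⟨(k - p).val, by simpa using hp⟩
    have hpred : k + (Nat.find hex : ZMod n) - 1 ∉ S := by
      obtain ⟨t, ht⟩ : ∃ t, Nat.find hex = t + 1 := Nat.exists_eq_succ_of_ne_zero fun h0 => by
        have := Nat.find_spec hex
        rw [h0] at this
        exact hkS (by simpa using this)
      have := Nat.find_min hex (m := t) (by omega)
      rw [ht]
      push_cast
      rwa [← add_assoc, add_sub_cancel_right]
    have hsucc : k - (Nat.find hex' : ZMod n) + 1 ∉ S := by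
      obtain ⟨t, ht⟩ : ∃ t, Nat.find hex' = t + 1 := Nat.exists_eq_succ_of_ne_zero fun h0 => by
        have := Nat.find_spec hex'
        rw [h0] at this
        exact hkS (by simpa using this)
      have := Nat.find_min hex' (m := t) (by omega)
      rw [ht]
      push_cast
      rwa [← sub_sub, sub_add_cancel]
    have hu := Nat.find_spec hex
    have hv := Nat.find_spec hex'
    generalize k + (Nat.find hex : ZMod n) = u at hu hpred
    generalize k - (Nat.find hex' : ZMod n) = v at hv hsucc
    by_cases huj : u = j
    · by_cases hvj : v = j
      · subst huj
        rw [hvj] at hsucc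
        refine ⟨u, hu, ?_⟩
        have : (w u : ℕ) ≠ 0 := fun h => hj0 (Fin.ext h)
        rw [if_pos (show u + 1 ∈ Finset.univ \ S by simpa using hsucc),
          if_pos (show u - 1 ∈ Finset.univ \ S by simpa using hpred)]
        omega
      · refine ⟨v, hv, ?_⟩
        rw [if_pos (show v + 1 ∈ Finset.univ \ S by simpa using hsucc), hj v hvj, Fin.val_two]
        omega
    · refine ⟨u, hu, ?_⟩
      rw [if_pos (show u - 1 ∈ Finset.univ \ S by simpa using hpred), hj u huj, Fin.val_two]
      omega
  · intro i
    have := (w i).2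
    simp only [Finset.mem_univ, if_true]
    split_ifs <;> omega

/-- The `2`s on `i, i + 1, …, i + m - 1` are a maximal arc of `2`s, and adding a grain there topples
just that arc. -/
def IsArc (w : ZMod n → Fin 3) (i : ZMod n) (m : ℕ) : Prop :=
  (∀ t < m, w (i + t) = 2) ∧ w (i + m) ≠ 2 ∧ w (i - 1) ≠ 2 ∧ (m + 1 = n → w (i - 1) = 0)

theorem avalancheMonomial_of_isArc (hn : 3 ≤ n) {w : ZMod n → Fin 3} {i : ZMod n} {m j : ℕ}
    (hmn : m < n) (hjm : j < m) (hw : IsArc w i m) :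
    avalancheMonomial (wheelGraph n) (wordSandpile w) (rimVertex n (i + j))
      = ∏ t ∈ Finset.range m, MvPolynomial.X (rimVertex n (i + t)) := by
  classical
  obtain ⟨htwo, hnext, hprev, hlast⟩ := hw
  have hmem : ∀ p, p ∈ (Finset.range m).image (fun t : ℕ => i + (t : ZMod n)) ↔
      ∃ t < m, i + (t : ZMod n) = p := by simp
  rw [avalancheMonomial_wordSandpile hn w _ ((Finset.range m).image fun t : ℕ => i + (t : ZMod n)),
    Finset.prod_image (injOn_add_natCast i hmn.le)]
  · intro S hS hS'
    -- The vertex of `S` closest to the added grain along the arc: it is either the site of that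
    -- grain, or its neighbour one step closer has toppled.
    obtain ⟨u, hu, hmin⟩ := Finset.exists_min_image
      ((Finset.range m).filter fun t : ℕ => i + (t : ZMod n) ∈ S) (fun t => Nat.dist t j) (by
        obtain ⟨p, hp⟩ := hS'
        obtain ⟨t, ht, rfl⟩ := (hmem p).1 (hS hp)
        exact ⟨t, by simpa using ⟨ht, hp⟩⟩)
    simp only [Finset.mem_filter, Finset.mem_range] at hu hmin
    refine ⟨i + u, hu.2, ?_⟩
    rw [htwo u hu.1, Fin.val_two]
    rcases lt_trichotomy u j with hlt | rfl | hlt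
    · rw [if_pos (show i + (u : ZMod n) + 1 ∈ _ \ S from ?_)]
      · omega
      · rw [Finset.mem_sdiff, hmem]
        refine ⟨⟨u + 1, by omega, by push_cast; ring⟩, fun h => ?_⟩
        have := hmin (u + 1) ⟨by omega, by push_cast; rwa [← add_assoc]⟩
        unfold Nat.dist at this
        omega
    · rw [if_pos rfl]
      omega
    · obtain ⟨v, rfl⟩ : ∃ v, u = v + 1 := ⟨u - 1, by omega⟩
      rw [if_pos (show i + ((v + 1 : ℕ) : ZMod n) - 1 ∈ _ \ S from ?_)]
      · omega
      · rw [Finset.mem_sdiff, hmem]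
        refine ⟨⟨v, by omega, by push_cast; ring⟩, fun h => ?_⟩
        have := hmin v ⟨by omega, by convert h using 1; push_cast; ring⟩
        unfold Nat.dist at this
        omega
  · intro p
    by_cases hp : p ∈ (Finset.range m).image (fun t : ℕ => i + (t : ZMod n))
    · have := (w p).2
      rw [if_pos hp]
      split_ifs <;> omega
    · rw [if_neg hp]
      have hk : p ≠ i + j := by
        rintro rfl
        exact hp ((hmem _).2 ⟨j, hjm, rfl⟩)
      rw [if_neg hk]
      have hlt := (w p).2
      have hupper : p + 1 ∈ (Finset.range m).image (fun t : ℕ => i + (t : ZMod n)) →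
          p = i - 1 := by
        intro h
        obtain ⟨t, ht, hpt⟩ := (hmem _).1 h
        rcases t with _ | t
        · rw [eq_sub_iff_add_eq, ← hpt]
          simp
        · refine absurd ((hmem p).2 ⟨t, by omega, ?_⟩) hp
          push_cast at hpt
          linear_combination hpt
      have hlower : p - 1 ∈ (Finset.range m).image (fun t : ℕ => i + (t : ZMod n)) →
          p = i + m := by
        intro h
        obtain ⟨t, ht, hpt⟩ := (hmem _).1 h
        rcases (show t + 1 < m ∨ t + 1 = m by omega) with h1 | h1
        · refine absurd ((hmem p).2 ⟨t + 1, h1, ?_⟩) hp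
          push_cast
          linear_combination hpt
        · rw [← h1]
          push_cast
          linear_combination -hpt
      have hprev' : (w (i - 1) : ℕ) ≠ 2 := fun h => hprev (Fin.ext h)
      have hnext' : (w (i + m) : ℕ) ≠ 2 := fun h => hnext (Fin.ext h)
      split_ifs with h1 h2 h2
      -- A vertex next to both ends of the arc forces `m + 1 = n`; it gains two grains and stays
      -- stable because its letter is 0.
      · have e1 := hupper h1
        have e2 := hlower h2
        have h0 : ((m + 1 : ℕ) : ZMod n) = 0 := by
          push_cast
          linear_combination e1 - e2
        rw [ZMod.natCast_eq_zero_iff] at h0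
        have := Nat.le_of_dvd (by omega) h0
        rw [e1, hlast (by omega)]
        simp
      · rw [← hupper h1] at hprev'
        omega
      · rw [← hlower h2] at hnext'
        omega
      · omega

end Wheel

/-! ### Classifying avalanches and counting the words for each -/

section AvalanchePolynomial

variable {n : ℕ}

theorem isGood_of_forall_ne (hn : 3 ≤ n) {w : ZMod n → Fin 3} {j : ZMod n}
    (hw : ∀ i, i ≠ j → w i = 2) : IsGood w := by
  classical
  have : Fact (1 < n) := ⟨by omega⟩
  have hj : j ≠ j + 1 := by simp
  -- Every 2 resets the state to `true`, so only the state just after `j` can be `false`, namely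
  -- when `w j = 0`.
  refine ⟨fun h => ?_, fun i => if i = j + 1 then decide (w j ≠ 0) else true, fun i => ?_⟩
  · have h2 := hw _ hj.symm
    rw [h] at h2
    revert h2
    simp
  · by_cases hi : i = j
    · subst hi
      simp only [if_neg hj, if_true]
      generalize w i = a
      revert a; decide
    · rw [hw i hi, step_two]
      exact if_neg (by simpa using hi)

/-- Both borders of the arc would be the exceptional vertex; this forces `m + 1 = n` and then a 0
there. -/
theorem not_isArc_of_isFull {w : ZMod n → Fin 3} (hw : IsFull w) {i : ZMod n} {m : ℕ}
    (hmn : m < n) : ¬ IsArc w i m := by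
  rintro ⟨-, hnext, hprev, hlast⟩
  obtain ⟨j, hj, hj0⟩ := hw
  have e1 : i + m = j := by_contra fun h => hnext (hj _ h)
  have e2 : i - 1 = j := by_contra fun h => hprev (hj _ h)
  have h0 : ((m + 1 : ℕ) : ZMod n) = 0 := by
    push_cast
    linear_combination e1 - e2
  rw [ZMod.natCast_eq_zero_iff] at h0
  have := Nat.le_of_dvd (by omega) h0
  exact hj0 (e2 ▸ hlast (by omega))

/-- A maximal arc containing a given vertex is unique. -/
theorem IsArc.eq_of_add_eq {w : ZMod n → Fin 3} {i i' : ZMod n} {m m' j j' : ℕ}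
    (h : IsArc w i m) (h' : IsArc w i' m') (hj : j < m) (hj' : j' < m')
    (heq : i + (j : ZMod n) = i' + j') : i = i' ∧ m = m' ∧ j = j' := by
  have hstart : ∀ {i i' : ZMod n} {m m' j j' : ℕ}, IsArc w i m → IsArc w i' m' → j < m → j' < m' →
      i + (j : ZMod n) = i' + j' → j ≤ j' := by
    intro i i' m m' j j' h h' hj hj' heq
    -- If `j' < j`, the border `i' - 1` lies inside the arc that starts at `i`.
    by_contra! hlt
    refine h'.2.2.1 ?_
    rw [← h.1 (j - j' - 1) (by omega)]
    congr 1
    rw [Nat.cast_sub (by omega), Nat.cast_sub hlt.le]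
    push_cast
    linear_combination -heq
  have hend : ∀ {i i' : ZMod n} {m m' j j' : ℕ}, IsArc w i m → IsArc w i' m' → j < m → j' < m' →
      i + (j : ZMod n) = i' + j' → m - j ≤ m' - j' := by
    intro i i' m m' j j' h h' hj hj' heq
    by_contra! hlt
    refine h'.2.1 ?_
    rw [← h.1 (j + (m' - j')) (by omega)]
    congr 1
    rw [Nat.cast_add, Nat.cast_sub hj'.le]
    linear_combination -heq
  have hjj : j = j' := le_antisymm (hstart h h' hj hj' heq) (hstart h' h hj' hj heq.symm)
  have hmm := le_antisymm (hend h h' hj hj' heq) (hend h' h hj' hj heq.symm)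
  subst hjj
  exact ⟨add_right_cancel heq, by omega, rfl⟩

variable [NeZero n]

theorem exists_isArc {w : ZMod n → Fin 3} {k : ZMod n} (hk : w k = 2) (hw : ¬ IsFull w) :
    ∃ (i : ZMod n) (m j : ℕ), m < n ∧ j < m ∧ IsArc w i m ∧ k = i + j := by
  classical
  obtain ⟨p, hp⟩ : ∃ p, w p ≠ 2 := by
    by_contra! h
    exact hw ⟨0, fun i _ => h i, by rw [h]; decide⟩
  have hback : ∃ t : ℕ, w (k - t) ≠ 2 := ⟨(k - p).val, by simpa using hp⟩
  have hforth : ∃ t : ℕ, w (k + t) ≠ 2 := ⟨(p - k).val, by simpa using hp⟩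
  obtain ⟨a, ha⟩ : ∃ a, Nat.find hback = a + 1 := Nat.exists_eq_succ_of_ne_zero fun h0 => by
    have := Nat.find_spec hback
    rw [h0] at this
    exact this (by simpa using hk)
  obtain ⟨b, hb⟩ : ∃ b, Nat.find hforth = b + 1 := Nat.exists_eq_succ_of_ne_zero fun h0 => by
    have := Nat.find_spec hforth
    rw [h0] at this
    exact this (by simpa using hk)
  have ha1 : w (k - ((a + 1 : ℕ) : ZMod n)) ≠ 2 := ha ▸ Nat.find_spec hback
  have ha2 : ∀ t ≤ a, w (k - (t : ZMod n)) = 2 := fun t ht =>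
    not_not.1 (Nat.find_min hback (m := t) (by omega))
  have hb1 : w (k + ((b + 1 : ℕ) : ZMod n)) ≠ 2 := hb ▸ Nat.find_spec hforth
  have hb2 : ∀ t ≤ b, w (k + (t : ZMod n)) = 2 := fun t ht =>
    not_not.1 (Nat.find_min hforth (m := t) (by omega))
  have han : a + 1 < n := by
    by_contra! h
    have hle : (k - p).val ≤ a := by
      have := ZMod.val_lt (k - p)
      omega
    have := ha2 _ hle
    rw [ZMod.natCast_zmod_val, sub_sub_cancel] at this
    exact hp this
  -- Otherwise the 2s ahead of `k` would reach round to the nearest non-2 behind it.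
  have hlt : a + b + 1 < n := by
    by_contra! h
    have := hb2 (n - (a + 1)) (by omega)
    rw [Nat.cast_sub han.le, ZMod.natCast_self, zero_sub, ← sub_eq_add_neg] at this
    exact ha1 this
  have htwo : ∀ t < a + b + 1, w (k - a + (t : ZMod n)) = 2 := by
    intro t ht
    rcases le_total t a with hta | hta
    · rw [← ha2 (a - t) (by omega), Nat.cast_sub hta]
      congr 1
      ring
    · rw [← hb2 (t - a) (by omega), Nat.cast_sub hta]
      congr 1
      ring
  have hprev : w (k - a - 1) ≠ 2 := by
    rwa [Nat.cast_add, Nat.cast_one, ← sub_sub] at ha1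
  refine ⟨k - a, a + b + 1, a, hlt, by omega, ⟨htwo, ?_, hprev, fun hm => ?_⟩, by ring⟩
  · convert hb1 using 2
    push_cast
    ring
  -- With a single vertex outside the arc, a nonzero letter there would make `w` full.
  · by_contra h0
    refine hw ⟨k - a - 1, fun i hi => ?_, h0⟩
    have hval := ZMod.val_lt (i - (k - (a : ZMod n)))
    have hne : (i - (k - (a : ZMod n))).val ≠ a + b + 1 := by
      intro hv
      apply hi
      have hcast := congrArg (Nat.cast : ℕ → ZMod n) hv
      have hzero := congrArg (Nat.cast : ℕ → ZMod n) hm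
      rw [ZMod.natCast_zmod_val] at hcast
      rw [ZMod.natCast_self] at hzero
      push_cast at hcast hzero
      linear_combination hcast + hzero
    have := htwo (i - (k - (a : ZMod n))).val (by omega)
    rwa [ZMod.natCast_zmod_val, add_sub_cancel] at this

open Classical in
theorem card_isGood_comp_add (P : (ZMod n → Fin 3) → Prop) [DecidablePred P]
    (k : ZMod n) :
    (Finset.univ.filter fun w : ZMod n → Fin 3 => IsGood w ∧ P fun i => w (i + k)).card
      = (Finset.univ.filter fun w : ZMod n → Fin 3 => IsGood w ∧ P w).card := by
  refine Finset.card_nbij' (fun w i => w (i + k)) (fun w i => w (i - k)) ?_ ?_ ?_ ?_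
  · intro w hw
    simpa [isGood_comp_add_iff] using hw
  · intro w hw
    simpa [sub_eq_add_neg, isGood_comp_add_iff] using hw
  · intro w _
    simp
  · intro w _
    simp

open Classical in
theorem card_isGood_apply_ne_two (k : ZMod n) :
    (Finset.univ.filter fun w : ZMod n → Fin 3 => IsGood w ∧ w k ≠ 2).card + 2
      = 2 * Nat.fib (2 * n - 1) := by
  have h := card_isGood_comp_add (fun w => w 0 ≠ 2) k
  simp only [zero_add] at h
  rw [← card_isGood_apply_zero_ne_two, h]

open Classical in
theorem card_isGood_isArc (hn : 3 ≤ n) {m : ℕ} (hm : 1 ≤ m) (hmn : m < n) (i : ZMod n) :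
    (Finset.univ.filter fun w : ZMod n → Fin 3 => IsGood w ∧ IsArc w i m).card
      = Nat.fib (2 * (n - m)) := by
  rcases (show m + 2 ≤ n ∨ m + 1 = n by omega) with h | h
  · rw [← card_isGood_maximal_arc hm h]
    refine Eq.trans ?_ (card_isGood_comp_add _ i)
    congr 1
    ext w
    simp only [Finset.mem_filter, Finset.mem_univ, true_and, IsArc, show ¬ m + 1 = n by omega,
      false_imp_iff, and_true, add_comm i, sub_eq_neg_add]
  -- The two borders coincide: the only word has a 0 at `i - 1` and 2s elsewhere, and `fib 2 = 1`.
  · rw [show n - m = 1 by omega]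
    have hcast : (m : ZMod n) = -1 := by
      have := congrArg (Nat.cast : ℕ → ZMod n) h
      rw [ZMod.natCast_self] at this
      push_cast at this
      linear_combination this
    change _ = 1
    rw [Finset.card_eq_one]
    refine ⟨Function.update (fun _ => 2) (i - 1) 0, ?_⟩
    ext w
    simp only [Finset.mem_filter, Finset.mem_univ, true_and, Finset.mem_singleton]
    constructor
    · rintro ⟨-, h1, -, -, h2⟩
      refine Function.eq_update_iff.2 ⟨h2 h, fun p hp => ?_⟩
      have hval := ZMod.val_lt (p - i)
      have hne : (p - i).val ≠ m := by
        intro hv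
        apply hp
        have hv' := congrArg (Nat.cast : ℕ → ZMod n) hv
        rw [ZMod.natCast_zmod_val, hcast] at hv'
        linear_combination hv'
      have := h1 (p - i).val (by omega)
      rwa [ZMod.natCast_zmod_val, add_sub_cancel] at this
    · rintro rfl
      refine ⟨isGood_of_forall_ne hn (j := i - 1) fun p hp => by simp [hp], fun t ht => ?_, ?_, ?_,
        fun _ => by simp⟩
      · refine Function.update_of_ne (fun heq => ?_) _ _
        have h0 : ((t + 1 : ℕ) : ZMod n) = 0 := by
          push_cast
          linear_combination heq
        rw [ZMod.natCast_eq_zero_iff] at h0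
        have := Nat.le_of_dvd (by omega) h0
        omega
      · rw [hcast, ← sub_eq_add_neg, Function.update_self]
        decide
      · rw [Function.update_self]
        decide

open Classical in
theorem card_isGood_isFull (hn : 3 ≤ n) (k : ZMod n) :
    (Finset.univ.filter fun w : ZMod n → Fin 3 => IsGood w ∧ IsFull w ∧ w k = 2).card = n := by
  -- The index `j ≠ k` stands for the word with a 1 at `j`; the index `k`, where a 1 is not allowed,
  -- stands for the constant word 2.
  have himage : (Finset.univ.filter fun w : ZMod n → Fin 3 => IsGood w ∧ IsFull w ∧ w k = 2)
      = Finset.univ.image fun j : ZMod n =>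
        Function.update (fun _ => (2 : Fin 3)) j (if j = k then 2 else 1) := by
    ext w
    simp only [Finset.mem_filter, Finset.mem_univ, true_and, Finset.mem_image]
    constructor
    · rintro ⟨-, ⟨j, hj, hj0⟩, hk⟩
      by_cases hj2 : w j = 2
      · refine ⟨k, ?_⟩
        funext i
        by_cases hi : i = j
        · subst hi
          by_cases hik : i = k <;> simp [hik, hj2, hk]
        · by_cases hik : i = k <;> simp [hik, hj i hi, hk]
      · have hj1 : w j = 1 := by
          generalize w j = a at hj0 hj2
          revert a; decide
        have hjk : j ≠ k := by
          rintro rfl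
          exact hj2 hk
        refine ⟨j, (Function.eq_update_iff.2 ⟨?_, hj⟩).symm⟩
        rw [if_neg hjk, hj1]
    · rintro ⟨j, rfl⟩
      have hne : ∀ i, i ≠ j → Function.update (fun _ => (2 : Fin 3)) j
          (if j = k then 2 else 1) i = 2 := fun i hi => by simp [hi]
      refine ⟨isGood_of_forall_ne hn hne, ⟨j, hne, ?_⟩, ?_⟩
      · rw [Function.update_self]
        split_ifs <;> decide
      · by_cases hjk : j = k
        · simp [hjk]
        · exact hne k (Ne.symm hjk)
  rw [himage, Finset.card_image_of_injective, Finset.card_univ, ZMod.card]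
  have hone : ∀ j j' : ZMod n, j ≠ k → Function.update (fun _ => (2 : Fin 3)) j
      (if j = k then 2 else 1) = Function.update (fun _ => (2 : Fin 3)) j'
      (if j' = k then 2 else 1) → j = j' := by
    intro j j' hjk h
    by_contra hjj
    have := congrFun h j
    rw [Function.update_self, if_neg hjk, Function.update_of_ne hjj] at this
    revert this
    decide
  intro j j' h
  by_cases hjk : j = k
  · by_cases hjk' : j' = k
    · rw [hjk, hjk']
    · exact (hone j' j hjk' h.symm).symm
  · exact hone j j' hjk h

-- Exactly one summand survives: no avalanche, a full one, or the one arc through `k`. In this form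
-- the sums over words and positions can be exchanged.
open Classical in
theorem avalancheMonomial_eq_sum (hn : 3 ≤ n) (w : ZMod n → Fin 3) (k : ZMod n) :
    avalancheMonomial (wheelGraph n) (wordSandpile w) (rimVertex n k)
      = (if w k ≠ 2 then 1 else 0)
        + (if IsFull w ∧ w k = 2 then ∏ i, MvPolynomial.X (rimVertex n i) else 0)
        + ∑ m ∈ Finset.Icc 1 (n - 1), ∑ i : ZMod n, ∑ j ∈ Finset.range m,
            if k = i + j then
              if IsArc w i m then ∏ t ∈ Finset.range m, MvPolynomial.X (rimVertex n (i + t)) else 0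
            else 0 := by
  by_cases hk : w k = 2
  · rw [if_neg (not_not.2 hk), zero_add]
    by_cases hw : IsFull w
    · rw [if_pos ⟨hw, hk⟩, avalancheMonomial_of_isFull hn hk hw, left_eq_add]
      refine Finset.sum_eq_zero fun m hm => Finset.sum_eq_zero fun i _ =>
        Finset.sum_eq_zero fun j _ => ?_
      rw [Finset.mem_Icc] at hm
      rw [if_neg (not_isArc_of_isFull hw (by omega)), ite_self]
    · rw [if_neg fun h => hw h.1, zero_add]
      obtain ⟨i, m, j, hmn, hjm, harc, hkij⟩ := exists_isArc hk hw
      have huniq : ∀ (i' : ZMod n) (m' j' : ℕ), j' < m' → ¬ (i' = i ∧ m' = m ∧ j' = j) →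
          (if k = i' + j' then if IsArc w i' m' then
            ∏ t ∈ Finset.range m', MvPolynomial.X (rimVertex n (i' + t)) else 0 else 0
            : MvPolynomial {v : Option (Fin n) // v ≠ none} ℤ) = 0 := by
        intro i' m' j' hj' hne
        by_cases h1 : k = i' + j'
        · rw [if_pos h1, if_neg fun h2 => hne (h2.eq_of_add_eq harc hj' hjm (h1.symm.trans hkij))]
        · rw [if_neg h1]
      rw [Finset.sum_eq_single m, Finset.sum_eq_single i, Finset.sum_eq_single j, if_pos hkij,
        if_pos harc, hkij, avalancheMonomial_of_isArc hn hmn hjm harc]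
      · exact fun j' hj' hne => huniq _ _ _ (Finset.mem_range.1 hj') fun h => hne h.2.2
      · exact fun h => absurd (Finset.mem_range.2 hjm) h
      · exact fun i' _ hne => Finset.sum_eq_zero fun j' hj' =>
          huniq _ _ _ (Finset.mem_range.1 hj') fun h => hne h.1
      · exact fun h => absurd (Finset.mem_univ _) h
      · exact fun m' _ hne => Finset.sum_eq_zero fun i' _ => Finset.sum_eq_zero fun j' hj' =>
          huniq _ _ _ (Finset.mem_range.1 hj') fun h => hne h.2.1
      · exact fun h => absurd (Finset.mem_Icc.2 ⟨by omega, by omega⟩) h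
  · rw [avalancheMonomial_of_ne_two hn hk, if_pos hk, if_neg fun h => hk h.2, add_zero,
      left_eq_add]
    refine Finset.sum_eq_zero fun m _ => Finset.sum_eq_zero fun i _ =>
      Finset.sum_eq_zero fun j hj => ?_
    by_cases h1 : k = i + j
    · rw [if_pos h1, if_neg]
      intro h
      rw [h1] at hk
      exact hk (h.1 j (Finset.mem_range.1 hj))
    · rw [if_neg h1]

theorem cyclicPolynomial_wheelVar (m : ℕ) :
    cyclicPolynomial m (wheelVar n)
      = ∑ i : ZMod n, ∏ t ∈ Finset.range m, MvPolynomial.X (rimVertex n (i + t)) := by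
  refine Fintype.sum_bijective (fun i : Fin n => ((i : ℕ) : ZMod n)) ?_ _ _ fun i => ?_
  · refine Function.bijective_iff_has_inverse.2
      ⟨fun i => ⟨i.val, ZMod.val_lt i⟩, fun i => ?_, fun i => ?_⟩
    · exact Fin.ext (ZMod.val_natCast_of_lt i.2)
    · simp
  · refine Finset.prod_congr rfl fun t _ => ?_
    unfold wheelVar
    congr 1
    refine Subtype.ext (congrArg some (Fin.ext ?_))
    change (i.1 + t) % n = (((i : ℕ) : ZMod n) + t).val
    rw [← Nat.cast_add, ZMod.val_natCast]

theorem prod_wheelVar :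
    ∏ i : Fin n, wheelVar n i = ∏ i : ZMod n, MvPolynomial.X (rimVertex n i) := by
  refine Fintype.prod_bijective (fun i : Fin n => ((i : ℕ) : ZMod n)) ?_ _ _ fun i => ?_
  · refine Function.bijective_iff_has_inverse.2
      ⟨fun i => ⟨i.val, ZMod.val_lt i⟩, fun i => ?_, fun i => ?_⟩
    · exact Fin.ext (ZMod.val_natCast_of_lt i.2)
    · simp
  · unfold wheelVar
    congr 1
    exact Subtype.ext (congrArg some (Fin.ext (ZMod.val_natCast_of_lt i.2).symm))

end AvalanchePolynomial

end AvalancheGraph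

/-! ### Summation over words and positions -/

theorem theorem5 (n : ℕ) (hn : 3 ≤ n) :
    AvalancheGraph.avalanchePolynomial (AvalancheGraph.wheelGraph n) none =
      (n : MvPolynomial {v : Option (Fin n) // v ≠ none} ℤ) ^ 2 *
          ∏ i : Fin n, AvalancheGraph.wheelVar n i
        + ∑ m ∈ Finset.Icc 1 (n - 1),
            (m : MvPolynomial {v : Option (Fin n) // v ≠ none} ℤ) *
              (Nat.fib (2 * (n - m)) : MvPolynomial {v : Option (Fin n) // v ≠ none} ℤ) *
              AvalancheGraph.cyclicPolynomial m (AvalancheGraph.wheelVar n)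
        + 2 * (n : MvPolynomial {v : Option (Fin n) // v ≠ none} ℤ) *
            ((Nat.fib (2 * n - 1) : MvPolynomial {v : Option (Fin n) // v ≠ none} ℤ) - 1) := by
  classical
  have : NeZero n := ⟨by omega⟩
  simp only [AvalancheGraph.cyclicPolynomial_wheelVar, AvalancheGraph.prod_wheelVar]
  rw [AvalancheGraph.avalanchePolynomial, AvalancheGraph.sum_recurrents_wheelGraph hn,
    Finset.sum_congr rfl fun w _ => ((AvalancheGraph.rimVertex n).sum_comp _).symm,
    Finset.sum_comm]
  simp only [AvalancheGraph.avalancheMonomial_eq_sum hn, Finset.sum_add_distrib]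
  have hconst : ∑ k : ZMod n, ∑ w : ZMod n → Fin 3 with AvalancheGraph.IsGood w,
      (if w k ≠ 2 then 1 else 0 : MvPolynomial {v : Option (Fin n) // v ≠ none} ℤ)
      = 2 * (n : MvPolynomial {v : Option (Fin n) // v ≠ none} ℤ) *
        ((Nat.fib (2 * n - 1) : MvPolynomial {v : Option (Fin n) // v ≠ none} ℤ) - 1) := by
    have hk : ∀ k : ZMod n, ∑ w : ZMod n → Fin 3 with AvalancheGraph.IsGood w,
        (if w k ≠ 2 then 1 else 0 : MvPolynomial {v : Option (Fin n) // v ≠ none} ℤ)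
        = 2 * Nat.fib (2 * n - 1) - 2 := by
      intro k
      rw [Finset.sum_boole, Finset.filter_filter, eq_sub_iff_add_eq]
      exact_mod_cast AvalancheGraph.card_isGood_apply_ne_two k
    rw [Finset.sum_congr rfl fun k _ => hk k, Finset.sum_const, Finset.card_univ, ZMod.card,
      nsmul_eq_mul]
    ring
  have hfull : ∑ k : ZMod n, ∑ w : ZMod n → Fin 3 with AvalancheGraph.IsGood w,
      (if AvalancheGraph.IsFull w ∧ w k = 2 then
        ∏ i, MvPolynomial.X (AvalancheGraph.rimVertex n i) else 0
        : MvPolynomial {v : Option (Fin n) // v ≠ none} ℤ)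
      = (n : MvPolynomial {v : Option (Fin n) // v ≠ none} ℤ) ^ 2 *
        ∏ i, MvPolynomial.X (AvalancheGraph.rimVertex n i) := by
    have hk : ∀ k : ZMod n, ∑ w : ZMod n → Fin 3 with AvalancheGraph.IsGood w,
        (if AvalancheGraph.IsFull w ∧ w k = 2 then
          ∏ i, MvPolynomial.X (AvalancheGraph.rimVertex n i) else 0
          : MvPolynomial {v : Option (Fin n) // v ≠ none} ℤ)
        = (n : MvPolynomial {v : Option (Fin n) // v ≠ none} ℤ) *
          ∏ i, MvPolynomial.X (AvalancheGraph.rimVertex n i) := by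
      intro k
      rw [← Finset.sum_filter, Finset.filter_filter, Finset.sum_const,
        AvalancheGraph.card_isGood_isFull hn, nsmul_eq_mul]
    rw [Finset.sum_congr rfl fun k _ => hk k, Finset.sum_const, Finset.card_univ, ZMod.card,
      nsmul_eq_mul]
    ring
  have harc : ∑ k : ZMod n, ∑ w : ZMod n → Fin 3 with AvalancheGraph.IsGood w,
      ∑ m ∈ Finset.Icc 1 (n - 1), ∑ i : ZMod n, ∑ j ∈ Finset.range m,
        (if k = i + j then if AvalancheGraph.IsArc w i m then
          ∏ t ∈ Finset.range m, MvPolynomial.X (AvalancheGraph.rimVertex n (i + t)) else 0 else 0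
          : MvPolynomial {v : Option (Fin n) // v ≠ none} ℤ)
      = ∑ m ∈ Finset.Icc 1 (n - 1), (m : MvPolynomial {v : Option (Fin n) // v ≠ none} ℤ) *
          (Nat.fib (2 * (n - m)) : MvPolynomial {v : Option (Fin n) // v ≠ none} ℤ) *
          ∑ i : ZMod n, ∏ t ∈ Finset.range m,
            MvPolynomial.X (AvalancheGraph.rimVertex n (i + t)) := by
    rw [Finset.sum_comm]
    -- For a fixed arc, each offset `j < m` is hit by exactly one `k`; this yields the factor `m`.
    have hw : ∀ w : ZMod n → Fin 3, ∑ k : ZMod n,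
        ∑ m ∈ Finset.Icc 1 (n - 1), ∑ i : ZMod n, ∑ j ∈ Finset.range m,
          (if k = i + j then if AvalancheGraph.IsArc w i m then
            ∏ t ∈ Finset.range m, MvPolynomial.X (AvalancheGraph.rimVertex n (i + t)) else 0 else 0
            : MvPolynomial {v : Option (Fin n) // v ≠ none} ℤ)
        = ∑ m ∈ Finset.Icc 1 (n - 1), ∑ i : ZMod n,
          ((m : MvPolynomial {v : Option (Fin n) // v ≠ none} ℤ) *
          if AvalancheGraph.IsArc w i m then
            ∏ t ∈ Finset.range m, MvPolynomial.X (AvalancheGraph.rimVertex n (i + t)) else 0) := by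
      intro w
      rw [Finset.sum_comm]
      refine Finset.sum_congr rfl fun m _ => ?_
      rw [Finset.sum_comm]
      refine Finset.sum_congr rfl fun i _ => ?_
      rw [Finset.sum_comm]
      simp only [Finset.sum_ite_eq', Finset.mem_univ, if_true, Finset.sum_const, Finset.card_range,
        nsmul_eq_mul]
    rw [Finset.sum_congr rfl fun w _ => hw w, Finset.sum_comm]
    refine Finset.sum_congr rfl fun m hm => ?_
    rw [Finset.mem_Icc] at hm
    rw [Finset.sum_comm, Finset.mul_sum]
    refine Finset.sum_congr rfl fun i _ => ?_
    rw [← Finset.mul_sum, ← Finset.sum_filter, Finset.filter_filter, Finset.sum_const,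
      AvalancheGraph.card_isGood_isArc hn hm.1 (by omega), nsmul_eq_mul, mul_assoc]
  rw [hconst, hfull, harc]
  ring
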